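/- **Setting.** Let $k\ge 1$, and let $\alpha\in C^\infty([0,2\pi])$ be real-valued with $\alpha(0)=\alpha(2\pi)$. Zeros and sign changes of $\alpha$ are allowed. Consider $u_t+(\alpha u)_x=g$ on $[0,2\pi]$ with periodic boundary condition. *Mesh.* Let $0=x_{1/2}<x_{3/2}<\dots<x_{N+1/2}=2\pi$ with $N\ge1$, $\mathbf V_i=[x_{i-1/2},x_{i+1/2}]$, $h_i=x_{i+1/2}-x_{i-1/2}$. The mesh is shape-regular with constant $\rho$ if $\max_j h_j\le\rho\,h_i$ for all $i$. Let $V_h$ be the space of functions whose restriction to each $\mathbf V_i$ is a polynomial of degree at most $k$; element indices are cyclic modulo $N$. *Control volumes.* Each element carries reference points $-1=s_0<s_1<\dots<s_{k+1}=1$ (which may depend on $i$), and $x_{i,j}=\frac{h_i}{2}s_j+\frac12(x_{i-1/2}+x_{i+1/2})$. With $L_n$ the Legendre polynomials ($L_n(1)=1$), the points are - *Gauss points* if $s_1,\dots,s_k$ are the zeros of $L_k$; - *right Radau points* if $s_1,\dots,s_{k+1}$ are the zeros of $L_{k+1}-L_k$; - *left Radau points* if $s_0,\dots,s_k$ are the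 zeros of $L_{k+1}+L_k$. In the *LSV* scheme every element uses Gauss points. In the *RSV* scheme $\mathbf V_i$ uses right Radau points if $\alpha(x_{i-1/2})>0$ and $\alpha(x_{i+1/2})>0$, left Radau points if $\alpha(x_{i-1/2})<0$ and $\alpha(x_{i+1/2})<0$, and otherwise either of the two. Let $A_0,\dots,A_{k+1}$ be the weights on $[-1,1]$ of the interpolatory quadrature whose abscissae are the zeros just listed, with $A_j=0$ if $s_j$ is not an abscissa, and let $A_{i,j}=\frac{h_i}{2}A_j$. *The map $w\mapsto w^*$.* For $w\in V_h$, $w^*$ is the piecewise constant function with value $w^*_{i,j}$ on $[x_{i,j},x_{i,j+1}]$, $0\le j\le k$, where $$w^*_{i,0}=w(x_{i-1/2}^+)+A_{i,0}w_x(x_{i,0}),\qquad w^*_{i,j}=w^*_{i,j-1}+A_{i,j}w_x(x_{i,j}),\quad 1\le j\le k,$$ and $w_x$ is the derivative of the polynomial $w|_{\mathbf V_i}$. *Forms and norms.* Let $\hat v$ be the upwind flux: at $x_{i+1/2}$ it equals the left limit of $v$ if $\alpha(x_{i+1/2})>0$ and the right limit if $\alpha(x_{i+1/2})\le0$, where limits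 across $0\sim2\pi$ are taken periodically; at the interior points $x_{i,1},\dots,x_{i,k}$ of an element, $\hat v=v$. For time-dependent $v$ in $V_h$ let $$a_{h,i}(v,w^*)=\sum_{j=0}^k w^*_{i,j}\int_{x_{i,j}}^{x_{i,j+1}}v_t\,dx+\sum_{j=0}^k w^*_{i,j}\big((\alpha\hat v)(x_{i,j+1})-(\alpha\hat v)(x_{i,j})\big),$$ $$\tilde\alpha_i^2=\alpha^2(x_{i-1/2})+\alpha^2(x_{i+1/2}),\qquad A_h(v,w^*)=\sum_{i=1}^N\tilde\alpha_i^2\,a_{h,i}(v,w^*),$$ $$\|v\|_\alpha^2=\sum_{i=1}^N\tilde\alpha_i^2\int_{\mathbf V_i}v^2\,dx,\qquad \||v|\|_\alpha^2=\sum_{i=1}^N\tilde\alpha_i^2\int_{\mathbf V_i}v\,v^*\,dx .$$ **Theorem 3.3.** For all $k$, $\alpha$ as above and every $\rho$ there is a constant $C>0$, depending only on $k$, $\alpha$ and $\rho$, such that for every mesh (with any number of elements) that is shape-regular with constant $\rho$, every $V_h$-valued function $v$ of time and every time $t$ at which $v$ is differentiable, the following hold at time $t$. For the RSV scheme, $\|v\|_\alpha^2$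 is differentiable at $t$ and $$\frac12\frac{d}{dt}\|v\|_\alpha^2\le C\big(|A_h(v,v^*)|+\|v\|_\alpha^2\big).$$ For the LSV scheme, $\||v|\|_\alpha^2$ is differentiable at $t$ and $$\frac12\frac{d}{dt}\||v|\|_\alpha^2\le C\big(|A_h(v,v^*)|+\||v|\|_\alpha^2\big).$$ -/

import Mathlib

open Polynomial

noncomputable section

namespace SpectralVolume

/-- The Legendre polynomial `L_n` on `[-1, 1]`, normalised by `L_n(1) = 1` (Rodrigues' formula). -/
def legendre (n : ℕ) : ℝ[X] :=
  C ((2 ^ n * (n.factorial : ℝ))⁻¹) * derivative^[n] ((X ^ 2 - 1) ^ n)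

/-- The three families of partition points of the reference element. -/
inductive NodeKind where
  | gauss
  | radauRight
  | radauLeft

/-- The polynomial of which the quadrature abscissae are the zeros: `L_k`, `L_{k+1} - L_k`,
`L_{k+1} + L_k`. -/
def nodePoly (k : ℕ) : NodeKind → ℝ[X]
  | .gauss => legendre k
  | .radauRight => legendre (k + 1) - legendre k
  | .radauLeft => legendre (k + 1) + legendre k

/-- The indices `j` among `0, …, k+1` for which `s_j` is a quadrature abscissa: `1, …, k` for Gauss
points, `1, …, k+1` for right Radau points, `0, …, k` for left Radau points. -/
def abscissae (k : ℕ) : NodeKind → Finset (Fin (k + 2))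
  | .gauss => Finset.univ.filter fun j => j ≠ 0 ∧ j ≠ Fin.last (k + 1)
  | .radauRight => Finset.univ.filter fun j => j ≠ 0
  | .radauLeft => Finset.univ.filter fun j => j ≠ Fin.last (k + 1)

/-- `-1 = s_0 < s_1 < ⋯ < s_{k+1} = 1` are the partition points of the given kind in the reference
element. -/
structure IsNodes (k : ℕ) (K : NodeKind) (s : Fin (k + 2) → ℝ) : Prop where
  strictMono : StrictMono s
  first : s 0 = -1
  last : s (Fin.last (k + 1)) = 1
  isRoot : ∀ j ∈ abscissae k K, (nodePoly k K).IsRoot (s j)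

/-- The weight `A_j` of the interpolatory quadrature on `[-1, 1]` with the given abscissae; it is `0`
at an end point which is not an abscissa. -/
def weight (k : ℕ) (K : NodeKind) (s : Fin (k + 2) → ℝ) (j : Fin (k + 2)) : ℝ :=
  if j ∈ abscissae k K then ∫ y in (-1 : ℝ)..1, (Lagrange.basis (abscissae k K) s j).eval y else 0

/-- A mesh of `[0, 2π]` with `N` elements, together with a partition of every element into `k + 1`
control volumes by Gauss, right Radau or left Radau points. The element with index `i : Fin N` is
`[pt i.castSucc, pt i.succ]`. -/
structure Grid (k N : ℕ) where
  pt : Fin (N + 1) → ℝ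
  strictMono : StrictMono pt
  first : pt 0 = 0
  last : pt (Fin.last N) = 2 * Real.pi
  kind : Fin N → NodeKind
  node : Fin N → Fin (k + 2) → ℝ
  isNodes : ∀ i, IsNodes k (kind i) (node i)

/-- The space `V_h` of (discontinuous) piecewise polynomials of degree at most `k`: one polynomial in
the variable `x` for every element. -/
abbrev DGSpace (k N : ℕ) : Type := Fin N → degreeLT ℝ (k + 1)

/-- The space of piecewise constant functions on the control volumes. -/
abbrev PCSpace (k N : ℕ) : Type := Fin N → Fin (k + 1) → ℝ

namespace Grid

variable {k N : ℕ} (G : Grid k N)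

/-- Left end point of an element. -/
def left (i : Fin N) : ℝ := G.pt i.castSucc

/-- Right end point of an element. -/
def right (i : Fin N) : ℝ := G.pt i.succ

/-- Length of an element. -/
def step (i : Fin N) : ℝ := G.right i - G.left i

/-- Shape regularity with constant `ρ`: the largest step is at most `ρ` times any step. -/
def ShapeRegular (ρ : ℝ) : Prop := ∀ i j, G.step j ≤ ρ * G.step i

/-- The points `x_{i,j}`. -/
def x (i : Fin N) (j : Fin (k + 2)) : ℝ :=
  G.step i / 2 * G.node i j + (G.left i + G.right i) / 2

/-- The weights `A_{i,j}` on the element with index `i`. -/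
def A (i : Fin N) (j : Fin (k + 2)) : ℝ :=
  G.step i / 2 * weight k (G.kind i) (G.node i) j

/-- The Gauss-Legendre spectral volume scheme. -/
def IsLSV : Prop := ∀ i, G.kind i = .gauss

/-- The Radau spectral volume scheme for the coefficient `α`. -/
def IsRSV (α : ℝ → ℝ) : Prop := ∀ i,
  (G.kind i = .radauRight ∨ G.kind i = .radauLeft) ∧
  (0 < α (G.left i) → 0 < α (G.right i) → G.kind i = .radauRight) ∧
  (α (G.left i) < 0 → α (G.right i) < 0 → G.kind i = .radauLeft)

/-- The values of `T w` for `w` in `V_h`: `w*_{i,0} = w(x_{i,0}) + A_{i,0} w_x(x_{i,0})` and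
`w*_{i,j} = w*_{i,j-1} + A_{i,j} w_x(x_{i,j})`, with the polynomial of the element `i` for `w`. -/
def star (w : DGSpace k N) : PCSpace k N := fun i j =>
  Fin.induction (motive := fun _ => ℝ)
    ((w i : ℝ[X]).eval (G.left i) + G.A i 0 * (derivative (w i : ℝ[X])).eval (G.x i 0))
    (fun j prev => prev +
      G.A i j.succ.castSucc * (derivative (w i : ℝ[X])).eval (G.x i j.succ.castSucc))
    j

/-- The value at `x_{i,j}` of the trace with upwind flux. For `j = 0` and `j = k + 1` it is the upwind
numerical flux, where the neighbours `i - 1`, `i + 1` in `Fin N` are taken cyclically, which is the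
periodic boundary condition; at the interior points it is the value of `v`. -/
def hat [NeZero N] (α : ℝ → ℝ) (v : DGSpace k N) (i : Fin N) (j : Fin (k + 2)) : ℝ :=
  if j = 0 then
    if 0 < α (G.left i) then (v (i - 1) : ℝ[X]).eval (G.right (i - 1))
    else (v i : ℝ[X]).eval (G.left i)
  else if j = Fin.last (k + 1) then
    if 0 < α (G.right i) then (v i : ℝ[X]).eval (G.right i)
    else (v (i + 1) : ℝ[X]).eval (G.left (i + 1))
  else (v i : ℝ[X]).eval (G.x i j)

/-- The local spectral volume form `a_{h,i}(v, w)` at time `t`, for a time-dependent `v` in `V_h` and a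
piecewise constant `w`; `v_t` is the time derivative. -/
def a [NeZero N] (α : ℝ → ℝ) (v : ℝ → DGSpace k N) (t : ℝ) (w : PCSpace k N) (i : Fin N) : ℝ :=
  (∑ j : Fin (k + 1), w i j *
    ∫ y in (G.x i j.castSucc)..(G.x i j.succ), deriv (fun τ => (v τ i : ℝ[X]).eval y) t) +
  ∑ j : Fin (k + 1), w i j *
    (α (G.x i j.succ) * G.hat α (v t) i j.succ -
      α (G.x i j.castSucc) * G.hat α (v t) i j.castSucc)

/-- The squared weight `α(x_{i-1/2})² + α(x_{i+1/2})²` of the element with index `i`. -/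
def wt (α : ℝ → ℝ) (i : Fin N) : ℝ := α (G.left i) ^ 2 + α (G.right i) ^ 2

/-- The weighted spectral volume form `A_h(v, w)` at time `t`. -/
def weightedForm [NeZero N] (α : ℝ → ℝ) (v : ℝ → DGSpace k N) (t : ℝ) (w : PCSpace k N) : ℝ :=
  ∑ i, G.wt α i * G.a α v t w i

/-- The square of the weighted norm, `‖v‖_α²`. -/
def normSq (α : ℝ → ℝ) (v : DGSpace k N) : ℝ :=
  ∑ i, G.wt α i * ∫ y in (G.left i)..(G.right i), (v i : ℝ[X]).eval y ^ 2

/-- The local square `(v, v*)_i` of the discrete norm. -/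
def localStarNormSq (v : DGSpace k N) (i : Fin N) : ℝ :=
  ∑ j : Fin (k + 1), G.star v i j *
    ∫ y in (G.x i j.castSucc)..(G.x i j.succ), (v i : ℝ[X]).eval y

/-- The square of the weighted discrete norm, `‖|v|‖_α²`. -/
def starNormSq (α : ℝ → ℝ) (v : DGSpace k N) : ℝ :=
  ∑ i, G.wt α i * G.localStarNormSq v i

end Grid

end SpectralVolume

end

/-!
The scheme is read as a discontinuous Galerkin scheme with quadrature. The quadrature on an element is
exact at least up to degree `2k - 1`, since the node polynomial is orthogonal to all polynomials of
degree less than `k`, so the partial sums `w*` run from `w` at the left end point to `w` at the right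
end point. Summation by parts (`Grid.sum_star_mul_sub`) thus replaces a sum of flux differences
against `w*` by boundary terms minus the quadrature of `w_x` times the flux.

*Time derivative.* Applied to a primitive of `q`, summation by parts shows that `(q, w*)` is the `L²`
inner product, which is exact for Radau points, plus for Gauss points a nonnegative multiple of the
product of the leading coefficients (`Grid.exists_star_inner_eq`). The form is therefore symmetric,
half the derivative of `(v, v*)` is `(v_t, v*)`, and `(v, v*)` dominates the `L²` norm. Both schemes
are treated at once with the discrete norm.

*Flux.* Freezing `α` on an element, the quadrature of `α v v_x` is half the difference of `α v²` at
the end points, up to a multiple of the squared `L²` norm, by the inverse inequality and the Lipschitz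
bound on `α` (`Grid.sum_A_mul_alpha_le`). At an interface with inner traces `a` and `b`, and squared
weights `s²` and `r²` of the two elements, the remaining terms are `|α|/2 (s a - r b)²` up to a cross
term `|α| (s - r) a b` with a factor `s` or `r`. As `|s - r|` is of the order of the step and `|α|` is
at most `s` and at most `r` at the interface, the cross term is bounded by the weighted norm
(`neg_interface_le`). This balance is what the weights `s²` achieve, near zeros of `α` in particular.
For Radau points an end point can be an abscissa which sees the value of the neighbour, but only if
the end values of `α` do not share a strict sign, and then the weight is of the order of the squared
step (`endpoint_correction_le`). Summation over the elements gives `Grid.neg_sum_wt_mul_flux_le`.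
-/

namespace SpectralVolume

/-! ### Integration of polynomials and orthogonality of the Legendre polynomials -/

lemma intervalIntegrable_eval (f : ℝ[X]) (a b : ℝ) :
    IntervalIntegrable (fun x => f.eval x) MeasureTheory.volume a b :=
  f.continuous.intervalIntegrable a b

/-- Integration over `[a, b]` as a linear functional on polynomials. -/
noncomputable def polyIntegral (a b : ℝ) : ℝ[X] →ₗ[ℝ] ℝ where
  toFun f := ∫ x in a..b, f.eval x
  map_add' f g := by
    simp only [eval_add]
    exact intervalIntegral.integral_add (intervalIntegrable_eval f a b)
      (intervalIntegrable_eval g a b)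
  map_smul' c f := by
    simp only [eval_smul, smul_eq_mul, RingHom.id_apply]
    exact intervalIntegral.integral_const_mul c _

lemma polyIntegral_apply (a b : ℝ) (f : ℝ[X]) :
    polyIntegral a b f = ∫ x in a..b, f.eval x := rfl

lemma polyIntegral_derivative (a b : ℝ) (f : ℝ[X]) :
    polyIntegral a b (derivative f) = f.eval b - f.eval a :=
  intervalIntegral.integral_eq_sub_of_hasDerivAt (fun x _ => f.hasDerivAt x)
    (intervalIntegrable_eval _ a b)

lemma polyIntegral_nonneg {a b : ℝ} (hab : a ≤ b) {f : ℝ[X]} (hf : ∀ x, 0 ≤ f.eval x) :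
    0 ≤ polyIntegral a b f :=
  intervalIntegral.integral_nonneg hab fun x _ => hf x

lemma polyIntegral_sq_nonneg {a b : ℝ} (hab : a ≤ b) (f : ℝ[X]) :
    0 ≤ polyIntegral a b (f ^ 2) :=
  polyIntegral_nonneg hab fun x => by rw [eval_pow]; positivity

lemma polyIntegral_comp (a b c d : ℝ) (f : ℝ[X]) :
    c * polyIntegral a b (f.comp (C c * X + C d)) = polyIntegral (c * a + d) (c * b + d) f := by
  simp only [polyIntegral_apply, eval_comp, eval_add, eval_mul, eval_C, eval_X]
  exact intervalIntegral.mul_integral_comp_mul_add (f := fun x => f.eval x) c d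

/-- Repeated integration by parts: no boundary terms occur as long as the lower derivatives of `g`
vanish at both end points. -/
lemma polyIntegral_mul_iterate_derivative_eq_zero {a b : ℝ} (g : ℝ[X]) (m : ℕ)
    (hg : ∀ l < m, (derivative^[l] g).eval a = 0 ∧ (derivative^[l] g).eval b = 0) (q : ℝ[X])
    (hq : q.degree < m) : polyIntegral a b (q * derivative^[m] g) = 0 := by
  induction m generalizing q with
  | zero =>
    have : q = 0 := by
      rw [← degree_eq_bot]
      simpa [Nat.WithBot.lt_zero_iff] using hq
    simp [this]
  | succ m ih =>
    have h1 : q * derivative^[m + 1] g =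
        derivative (q * derivative^[m] g) - derivative q * derivative^[m] g := by
      rw [derivative_mul, Function.iterate_succ_apply']; ring
    have h2 : (derivative q).degree < m := by
      rcases eq_or_ne q 0 with rfl | h0
      · simp
      · have h3 := degree_derivative_lt h0
        have h4 : q.degree ≤ (m : WithBot ℕ) := by
          have := hq
          rw [degree_eq_natDegree h0] at this ⊢
          norm_cast at this ⊢
          omega
        exact lt_of_lt_of_le h3 h4
    rw [h1, map_sub, polyIntegral_derivative,
      ih (fun l hl => hg l (by omega)) _ h2, eval_mul, eval_mul, (hg m (by omega)).1,
      (hg m (by omega)).2]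
    ring

lemma polyIntegral_mul_legendre (n : ℕ) (q : ℝ[X]) (hq : q.degree < n) :
    polyIntegral (-1) 1 (q * legendre n) = 0 := by
  have h : q * legendre n = ((2 ^ n * (n.factorial : ℝ))⁻¹) •
      (q * derivative^[n] ((X ^ 2 - 1) ^ n)) := by
    rw [legendre, smul_eq_C_mul]; ring
  rw [h, map_smul, polyIntegral_mul_iterate_derivative_eq_zero _ n _ q hq, smul_zero]
  intro l hl
  have hd : (X ^ 2 - 1 : ℝ[X]) ∣ derivative^[l] ((X ^ 2 - 1) ^ n) :=
    (dvd_pow_self _ (by omega)).trans (pow_sub_dvd_iterate_derivative_pow _ n l)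
  obtain ⟨r, hr⟩ := hd
  simp [hr]

lemma natDegree_legendre_le (n : ℕ) : (legendre n).natDegree ≤ n := by
  refine (natDegree_C_mul_le _ _).trans ((natDegree_iterate_derivative _ _).trans ?_)
  have h : ((X ^ 2 - 1 : ℝ[X]) ^ n).natDegree ≤ n * 2 :=
    natDegree_pow_le_of_le n (by compute_degree)
  omega

lemma coeff_legendre_ne_zero (n : ℕ) : (legendre n).coeff n ≠ 0 := by
  have h1 : ((X ^ 2 - 1 : ℝ[X]) ^ n).coeff (n * 2) = 1 := by
    have h2 : (X ^ 2 - 1 : ℝ[X]).natDegree ≤ 2 := by compute_degree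
    rw [coeff_pow_of_natDegree_le h2]
    simp [coeff_one]
  rw [legendre, coeff_C_mul, coeff_iterate_derivative, ← mul_two, h1]
  have : (n * 2).descFactorial n ≠ 0 := by
    rw [Ne, Nat.descFactorial_eq_zero_iff_lt]; omega
  simp [this, Nat.factorial_ne_zero]

lemma degree_legendre (n : ℕ) : (legendre n).degree = n :=
  degree_eq_of_le_of_coeff_ne_zero
    (natDegree_le_iff_degree_le.1 (natDegree_legendre_le n)) (coeff_legendre_ne_zero n)

/-! ### The quadrature on the reference element -/

lemma card_abscissae_gauss (k : ℕ) : (abscissae k .gauss).card = k := by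
  have h : abscissae k .gauss = (Finset.univ.erase 0).erase (Fin.last (k + 1)) := by
    ext j; simp [abscissae, and_comm]
  rw [h, Finset.card_erase_of_mem (by simp [Fin.ext_iff]), Finset.card_erase_of_mem (by simp)]
  simp

lemma card_abscissae_radauRight (k : ℕ) : (abscissae k .radauRight).card = k + 1 := by
  have h : abscissae k .radauRight = Finset.univ.erase 0 := by
    ext j; simp [abscissae]
  rw [h, Finset.card_erase_of_mem (by simp)]
  simp

lemma card_abscissae_radauLeft (k : ℕ) : (abscissae k .radauLeft).card = k + 1 := by
  have h : abscissae k .radauLeft = Finset.univ.erase (Fin.last (k + 1)) := by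
    ext j; simp [abscissae]
  rw [h, Finset.card_erase_of_mem (by simp)]
  simp

lemma degree_nodePoly (k : ℕ) (K : NodeKind) :
    (nodePoly k K).degree = ((abscissae k K).card : WithBot ℕ) := by
  have hlt : (legendre k).degree < (legendre (k + 1)).degree := by
    rw [degree_legendre, degree_legendre]; exact_mod_cast Nat.lt_succ_self k
  cases K with
  | gauss => rw [card_abscissae_gauss, nodePoly, degree_legendre]
  | radauRight =>
    rw [card_abscissae_radauRight, nodePoly, degree_sub_eq_left_of_degree_lt hlt, degree_legendre]
  | radauLeft =>
    rw [card_abscissae_radauLeft, nodePoly, degree_add_eq_left_of_degree_lt hlt, degree_legendre]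

lemma polyIntegral_mul_nodePoly (k : ℕ) (K : NodeKind) (q : ℝ[X]) (hq : q.degree < k) :
    polyIntegral (-1) 1 (q * nodePoly k K) = 0 := by
  have h0 := polyIntegral_mul_legendre k q hq
  have h1 := polyIntegral_mul_legendre (k + 1) q
    (hq.trans (by exact_mod_cast Nat.lt_succ_self k))
  cases K with
  | gauss => exact h0
  | radauRight => rw [nodePoly, mul_sub, map_sub, h0, h1, sub_zero]
  | radauLeft => rw [nodePoly, mul_add, map_add, h0, h1, add_zero]

/-- The interpolatory quadrature on the reference element, as a linear functional. -/
noncomputable def refQuad (k : ℕ) (K : NodeKind) (s : Fin (k + 2) → ℝ) : ℝ[X] →ₗ[ℝ] ℝ :=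
  ∑ j, weight k K s j • leval (s j)

lemma refQuad_apply (k : ℕ) (K : NodeKind) (s : Fin (k + 2) → ℝ) (f : ℝ[X]) :
    refQuad k K s f = ∑ j, weight k K s j * f.eval (s j) := by
  simp [refQuad]

variable {k : ℕ} {K : NodeKind} {s : Fin (k + 2) → ℝ}

lemma refQuad_congr {f g : ℝ[X]} (h : ∀ j ∈ abscissae k K, f.eval (s j) = g.eval (s j)) :
    refQuad k K s f = refQuad k K s g := by
  rw [refQuad_apply, refQuad_apply]
  refine Finset.sum_congr rfl fun j _ => ?_
  by_cases hj : j ∈ abscissae k K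
  · rw [h j hj]
  · simp [weight, hj]

lemma refQuad_eq_polyIntegral_of_degree_lt_card (hs : IsNodes k K s) {f : ℝ[X]}
    (hf : f.degree < (abscissae k K).card) : refQuad k K s f = polyIntegral (-1) 1 f := by
  have hinj : Set.InjOn s (abscissae k K) := hs.strictMono.injective.injOn
  conv_rhs => rw [Lagrange.eq_interpolate hinj hf, Lagrange.interpolate_apply]
  rw [refQuad_apply, map_sum, ← Finset.sum_subset (Finset.subset_univ (abscissae k K))]
  · refine Finset.sum_congr rfl fun j hj => ?_
    rw [← smul_eq_C_mul, map_smul, weight, if_pos hj, polyIntegral_apply, smul_eq_mul, mul_comm]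
  · intro j _ hj
    simp [weight, hj]

/-- The quadrature with `m` abscissae is exact up to degree `m + k - 1`, because the node polynomial
is orthogonal to all polynomials of degree less than `k`. -/
lemma refQuad_eq_polyIntegral (hs : IsNodes k K s) {f : ℝ[X]}
    (hf : f.natDegree < (abscissae k K).card + k) :
    refQuad k K s f = polyIntegral (-1) 1 f := by
  set P := nodePoly k K with hP
  have hdP : P.degree = ((abscissae k K).card : WithBot ℕ) := degree_nodePoly k K
  have hP0 : P ≠ 0 := by
    intro h; rw [h, degree_zero] at hdP; exact (WithBot.bot_ne_coe hdP)
  have hnP : P.natDegree = (abscissae k K).card := natDegree_eq_of_degree_eq_some hdP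
  have hdiv : P * (f / P) + f % P = f := EuclideanDomain.div_add_mod f P
  have hmod : (f % P).degree < (abscissae k K).card := hdP ▸ EuclideanDomain.mod_lt f hP0
  have hq : (f / P).degree < k := by
    rcases eq_or_ne (f / P) 0 with h | h
    · rw [h, degree_zero]; exact WithBot.bot_lt_coe k
    · have hle : P.degree ≤ f.degree := by
        by_contra hcon
        exact h ((Polynomial.div_eq_zero_iff hP0).2 (not_le.1 hcon))
      have hf0 : f ≠ 0 := by rintro rfl; simp at h
      have hadd := degree_add_div hP0 hle
      rw [degree_eq_natDegree hP0, degree_eq_natDegree h, degree_eq_natDegree hf0, hnP] at hadd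
      norm_cast at hadd
      rw [degree_eq_natDegree h]
      exact_mod_cast (by omega : (f / P).natDegree < k)
  have h1 : refQuad k K s f = refQuad k K s (f % P) := by
    refine refQuad_congr fun j hj => ?_
    have h0 : P.eval (s j) = 0 := hs.isRoot j hj
    conv_lhs => rw [← hdiv]
    rw [eval_add, eval_mul, h0, zero_mul, zero_add]
  rw [h1, refQuad_eq_polyIntegral_of_degree_lt_card hs hmod]
  conv_rhs => rw [← hdiv]
  rw [map_add, mul_comm, polyIntegral_mul_nodePoly k K _ hq, zero_add]

lemma le_card_abscissae (k : ℕ) (K : NodeKind) : k ≤ (abscissae k K).card := by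
  cases K with
  | gauss => exact (card_abscissae_gauss k).ge
  | radauRight => rw [card_abscissae_radauRight]; omega
  | radauLeft => rw [card_abscissae_radauLeft]; omega

/-- The weights are nonnegative, being the integrals of the squares of the Lagrange basis
polynomials. -/
lemma weight_nonneg (hk : 1 ≤ k) (hs : IsNodes k K s) (j : Fin (k + 2)) :
    0 ≤ weight k K s j := by
  by_cases hj : j ∈ abscissae k K
  · have hinj : Set.InjOn s (abscissae k K) := hs.strictMono.injective.injOn
    set l := Lagrange.basis (abscissae k K) s j with hl
    have hdeg : l.natDegree = (abscissae k K).card - 1 :=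
      natDegree_eq_of_degree_eq_some (Lagrange.degree_basis hinj hj)
    have hcard := le_card_abscissae k K
    have hcard' : (abscissae k K).card ≤ k + 1 := by
      cases K with
      | gauss => rw [card_abscissae_gauss]; omega
      | radauRight => rw [card_abscissae_radauRight]
      | radauLeft => rw [card_abscissae_radauLeft]
    have hex : refQuad k K s (l ^ 2) = polyIntegral (-1) 1 (l ^ 2) := by
      refine refQuad_eq_polyIntegral hs (lt_of_le_of_lt natDegree_pow_le ?_)
      rw [hdeg]; omega
    have hval : refQuad k K s (l ^ 2) = weight k K s j := by
      rw [refQuad_apply, Finset.sum_eq_single j]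
      · rw [eval_pow, Lagrange.eval_basis_self hinj hj]; ring
      · intro i _ hij
        by_cases hi : i ∈ abscissae k K
        · rw [eval_pow, Lagrange.eval_basis_of_ne hij.symm hi]; ring
        · simp [weight, hi]
      · simp
    rw [← hval, hex]
    exact polyIntegral_sq_nonneg (by norm_num) l
  · simp [weight, hj]

/-! ### Inverse inequalities for polynomials of degree at most `k` -/

/-- All norms on the finite-dimensional space of polynomials of degree less than `n` are equivalent;
here the coefficients are bounded by the `L²` norm. -/
lemma exists_coeff_sq_le (n : ℕ) : ∃ c : ℝ, 0 < c ∧ ∀ p ∈ degreeLT ℝ n, ∀ j,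
    p.coeff j ^ 2 ≤ c * polyIntegral (-1) 1 (p ^ 2) := by
  let core : InnerProductSpace.Core ℝ (degreeLT ℝ n) :=
    { inner := fun p q => polyIntegral (-1) 1 ((p : ℝ[X]) * q)
      conj_inner_symm := fun p q => by simp [mul_comm]
      re_inner_nonneg := fun p => by
        have := polyIntegral_sq_nonneg (a := -1) (b := 1) (by norm_num) (p : ℝ[X])
        simpa [sq] using this
      add_left := fun p q r => by simp [add_mul]
      smul_left := fun p q r => by simp
      definite := fun p hp => by
        by_contra h0
        have hp0 : (p : ℝ[X]) ≠ 0 := fun h => h0 (Subtype.ext h)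
        have hfin := (p : ℝ[X]).rootSet_finite ℝ
        obtain ⟨x, hx, hxr⟩ : ∃ x ∈ Set.Ioo (-1 : ℝ) 1, (p : ℝ[X]).eval x ≠ 0 := by
          by_contra hcon
          push Not at hcon
          refine (Set.Ioo_infinite (show (-1 : ℝ) < 1 by norm_num)) (hfin.subset fun x hx => ?_)
          rw [mem_rootSet]
          exact ⟨hp0, by simpa using hcon x hx⟩
        have hpos : 0 < ∫ y in (-1 : ℝ)..1, ((p : ℝ[X]) * p).eval y := by
          refine intervalIntegral.integral_pos (by norm_num)
            ((p : ℝ[X]) * p).continuous.continuousOn (fun y _ => ?_) ⟨x, ⟨hx.1.le, hx.2.le⟩, ?_⟩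
          · rw [eval_mul]; exact mul_self_nonneg _
          · rw [eval_mul]; exact mul_self_pos.2 hxr
        exact hpos.ne' hp }
  let _ : NormedAddCommGroup (degreeLT ℝ n) := core.toNormedAddCommGroup
  let _ : InnerProductSpace ℝ (degreeLT ℝ n) := InnerProductSpace.ofCore core.toCore
  have _ : FiniteDimensional ℝ (degreeLT ℝ n) :=
    (degreeLTEquiv ℝ n).symm.finiteDimensional
  let f : ℕ → (degreeLT ℝ n →L[ℝ] ℝ) := fun j =>
    LinearMap.toContinuousLinearMap ((lcoeff ℝ j).comp (degreeLT ℝ n).subtype)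
  refine ⟨∑ j ∈ Finset.range n, ‖f j‖ ^ 2 + 1, by positivity, fun p hp j => ?_⟩
  have hnorm : ‖(⟨p, hp⟩ : degreeLT ℝ n)‖ ^ 2 = polyIntegral (-1) 1 (p ^ 2) := by
    rw [← real_inner_self_eq_norm_sq, sq]
    rfl
  have hI : 0 ≤ polyIntegral (-1) 1 (p ^ 2) := polyIntegral_sq_nonneg (by norm_num) p
  rcases lt_or_ge j n with hj | hj
  · have h1 : ‖p.coeff j‖ ≤ ‖f j‖ * ‖(⟨p, hp⟩ : degreeLT ℝ n)‖ :=
      (f j).le_opNorm ⟨p, hp⟩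
    have h2 : p.coeff j ^ 2 ≤ ‖f j‖ ^ 2 * polyIntegral (-1) 1 (p ^ 2) := by
      rw [← hnorm, ← mul_pow, ← sq_abs, ← Real.norm_eq_abs]
      exact pow_le_pow_left₀ (norm_nonneg _) h1 2
    have h3 : ‖f j‖ ^ 2 ≤ ∑ j ∈ Finset.range n, ‖f j‖ ^ 2 :=
      Finset.single_le_sum (f := fun j => ‖f j‖ ^ 2) (fun _ _ => by positivity)
        (Finset.mem_range.2 hj)
    exact h2.trans (mul_le_mul_of_nonneg_right (by linarith) hI)
  · rw [coeff_eq_zero_of_degree_lt ((mem_degreeLT.1 hp).trans_le (by exact_mod_cast hj))]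
    rw [zero_pow two_ne_zero]
    positivity

lemma natDegree_lt_of_mem_degreeLT {k : ℕ} {p : ℝ[X]} (hp : p ∈ degreeLT ℝ (k + 1)) :
    p.natDegree < k + 1 := by
  rcases eq_or_ne p 0 with rfl | h
  · simp
  · exact (natDegree_lt_iff_degree_lt h).2 (mem_degreeLT.1 hp)

lemma eval_sq_le_of_coeff_sq_le {n : ℕ} {p : ℝ[X]} (hp : p.natDegree < n) {B : ℝ}
    (hB : ∀ j, p.coeff j ^ 2 ≤ B) {x : ℝ} (hx : |x| ≤ 1) : p.eval x ^ 2 ≤ n ^ 2 * B := by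
  have hB0 : 0 ≤ B := (sq_nonneg _).trans (hB 0)
  have h1 : |p.eval x| ≤ n * √B := by
    rw [eval_eq_sum_range' hp]
    calc _ ≤ ∑ i ∈ Finset.range n, |p.coeff i * x ^ i| := Finset.abs_sum_le_sum_abs _ _
      _ ≤ ∑ i ∈ Finset.range n, √B := Finset.sum_le_sum fun i _ => by
          rw [abs_mul, abs_pow]
          calc _ ≤ |p.coeff i| * 1 :=
                mul_le_mul_of_nonneg_left (pow_le_one₀ (abs_nonneg _) hx) (abs_nonneg _)
            _ ≤ √B := by rw [mul_one]; exact Real.abs_le_sqrt (hB i)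
      _ = n * √B := by simp
  calc p.eval x ^ 2 = |p.eval x| ^ 2 := (sq_abs _).symm
    _ ≤ (n * √B) ^ 2 := pow_le_pow_left₀ (abs_nonneg _) h1 2
    _ = n ^ 2 * B := by rw [mul_pow, Real.sq_sqrt hB0]

lemma exists_eval_sq_le_reference (k : ℕ) : ∃ c : ℝ, 0 < c ∧ ∀ p ∈ degreeLT ℝ (k + 1),
    ∀ x : ℝ, |x| ≤ 1 → p.eval x ^ 2 ≤ c * polyIntegral (-1) 1 (p ^ 2) ∧
      (derivative p).eval x ^ 2 ≤ c * polyIntegral (-1) 1 (p ^ 2) := by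
  obtain ⟨c, hc, h⟩ := exists_coeff_sq_le (k + 1)
  refine ⟨((k + 1 : ℕ) : ℝ) ^ 2 * (((k + 1 : ℕ) : ℝ) ^ 2 * c), by positivity,
    fun p hp x hx => ?_⟩
  have hdeg := natDegree_lt_of_mem_degreeLT hp
  have hI : 0 ≤ polyIntegral (-1) 1 (p ^ 2) := polyIntegral_sq_nonneg (by norm_num) p
  have hone : (1 : ℝ) ≤ ((k + 1 : ℕ) : ℝ) ^ 2 :=
    one_le_pow₀ (by exact_mod_cast Nat.succ_le_succ (Nat.zero_le k))
  have hB : ∀ j, p.coeff j ^ 2 ≤ ((k + 1 : ℕ) : ℝ) ^ 2 * (c * polyIntegral (-1) 1 (p ^ 2)) :=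
    fun j => (h p hp j).trans (le_mul_of_one_le_left (by positivity) hone)
  have hB' : ∀ j, (derivative p).coeff j ^ 2 ≤
      ((k + 1 : ℕ) : ℝ) ^ 2 * (c * polyIntegral (-1) 1 (p ^ 2)) := by
    intro j
    rw [coeff_derivative, mul_pow, mul_comm]
    rcases lt_or_ge j (k + 1) with hj | hj
    · have h1 : ((j : ℝ) + 1) ^ 2 ≤ ((k + 1 : ℕ) : ℝ) ^ 2 :=
        pow_le_pow_left₀ (by positivity) (by exact_mod_cast hj) 2
      exact mul_le_mul h1 (h p hp _) (sq_nonneg _) (by positivity)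
    · rw [coeff_eq_zero_of_natDegree_lt (by omega)]
      have : 0 ≤ ((k + 1 : ℕ) : ℝ) ^ 2 * (c * polyIntegral (-1) 1 (p ^ 2)) := by positivity
      simpa using this
  have hdeg' : (derivative p).natDegree < k + 1 :=
    (natDegree_derivative_le p).trans_lt (by omega)
  constructor
  · exact (eval_sq_le_of_coeff_sq_le hdeg hB hx).trans_eq (by ring)
  · exact (eval_sq_le_of_coeff_sq_le hdeg' hB' hx).trans_eq (by ring)

/-- Inverse inequalities on an interval of arbitrary length: the pointwise size of a polynomial and
of its derivative are controlled by its `L²` norm with the right power of the length. -/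
lemma exists_inverse_inequality (k : ℕ) : ∃ c : ℝ, 0 < c ∧ ∀ p ∈ degreeLT ℝ (k + 1),
    ∀ a b : ℝ, a < b → ∀ x ∈ Set.Icc a b,
      (b - a) * p.eval x ^ 2 ≤ c * polyIntegral a b (p ^ 2) ∧
      (b - a) ^ 3 * (derivative p).eval x ^ 2 ≤ c * polyIntegral a b (p ^ 2) := by
  obtain ⟨c, hc, h⟩ := exists_eval_sq_le_reference k
  refine ⟨8 * c, by positivity, fun p hp a b hab x hx => ?_⟩
  set r := (b - a) / 2 with hr
  set m := (a + b) / 2 with hm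
  have hr0 : 0 < r := by rw [hr]; linarith
  have hba : b - a = 2 * r := by rw [hr]; ring
  set q := p.comp (C r * X + C m) with hq
  have hqmem : q ∈ degreeLT ℝ (k + 1) := by
    rw [mem_degreeLT]
    refine lt_of_le_of_lt degree_le_natDegree ?_
    have h1 : q.natDegree ≤ p.natDegree * 1 :=
      natDegree_comp_le.trans (Nat.mul_le_mul_left _ natDegree_linear_le)
    have h2 := natDegree_lt_of_mem_degreeLT hp
    exact_mod_cast (by omega : q.natDegree < k + 1)
  have hint : r * polyIntegral (-1) 1 (q ^ 2) = polyIntegral a b (p ^ 2) := by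
    have h1 := polyIntegral_comp (-1) 1 r m (p ^ 2)
    rw [pow_comp] at h1
    rw [h1, show r * -1 + m = a by rw [hr, hm]; ring, show r * 1 + m = b by rw [hr, hm]; ring]
  have hxy : r * ((x - m) / r) + m = x := by rw [mul_div_cancel₀ _ hr0.ne', sub_add_cancel]
  have hy : |(x - m) / r| ≤ 1 := by
    rw [abs_div, abs_of_pos hr0, div_le_one hr0, abs_le]
    have h1 := hx.1
    have h2 := hx.2
    rw [hr, hm]
    constructor <;> linarith
  obtain ⟨h1, h2⟩ := h q hqmem _ hy
  have e1 : q.eval ((x - m) / r) = p.eval x := by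
    rw [hq, eval_comp]; simp [hxy]
  have e2 : (derivative q).eval ((x - m) / r) = r * (derivative p).eval x := by
    rw [hq, derivative_comp, eval_mul, eval_comp]; simp [hxy]
  rw [e1] at h1
  rw [e2] at h2
  have hI : 0 ≤ polyIntegral (-1) 1 (q ^ 2) := polyIntegral_sq_nonneg (by norm_num) q
  rw [hba, ← hint]
  constructor
  · nlinarith [mul_le_mul_of_nonneg_left h1 hr0.le, mul_nonneg (mul_nonneg hc.le hr0.le) hI]
  · nlinarith [mul_le_mul_of_nonneg_left h2 hr0.le]

/-! ### The quadrature on the elements -/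

namespace Grid

variable {k N : ℕ} (G : Grid k N)

lemma left_lt_right (i : Fin N) : G.left i < G.right i :=
  G.strictMono (Fin.castSucc_lt_succ)

lemma step_pos (i : Fin N) : 0 < G.step i := sub_pos.2 (G.left_lt_right i)

lemma x_zero (i : Fin N) : G.x i 0 = G.left i := by
  rw [x, (G.isNodes i).first, step]; ring

lemma x_last (i : Fin N) : G.x i (Fin.last (k + 1)) = G.right i := by
  rw [x, (G.isNodes i).last, step]; ring

lemma x_mem (i : Fin N) (j : Fin (k + 2)) : G.x i j ∈ Set.Icc (G.left i) (G.right i) := by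
  have h := G.step_pos i
  have h1 : -1 ≤ G.node i j := by
    rw [← (G.isNodes i).first]; exact (G.isNodes i).strictMono.monotone (Fin.zero_le j)
  have h2 : G.node i j ≤ 1 := by
    rw [← (G.isNodes i).last]; exact (G.isNodes i).strictMono.monotone (Fin.le_last j)
  rw [x]
  have h3 := mul_le_mul_of_nonneg_left h1 (half_pos h).le
  have h4 := mul_le_mul_of_nonneg_left h2 (half_pos h).le
  simp only [step] at *
  constructor <;> linarith

lemma A_nonneg (hk : 1 ≤ k) (i : Fin N) (j : Fin (k + 2)) : 0 ≤ G.A i j :=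
  mul_nonneg (half_pos (G.step_pos i)).le (weight_nonneg hk (G.isNodes i) j)

lemma A_eq_zero_of_notMem (i : Fin N) {j : Fin (k + 2)} (hj : j ∉ abscissae k (G.kind i)) :
    G.A i j = 0 := by
  simp [A, weight, hj]

lemma sum_A_mul_eval (i : Fin N) {f : ℝ[X]}
    (hf : f.natDegree < (abscissae k (G.kind i)).card + k) :
    ∑ j, G.A i j * f.eval (G.x i j) = polyIntegral (G.left i) (G.right i) f := by
  set m := (G.left i + G.right i) / 2 with hm
  have h1 : (f.comp (C (G.step i / 2) * X + C m)).natDegree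
      < (abscissae k (G.kind i)).card + k := by
    have h2 := natDegree_comp_le.trans
      (Nat.mul_le_mul_left f.natDegree (natDegree_linear_le (a := G.step i / 2) (b := m)))
    omega
  have h2 := refQuad_eq_polyIntegral (G.isNodes i) h1
  have h3 := polyIntegral_comp (-1) 1 (G.step i / 2) m f
  rw [← h2, refQuad_apply, Finset.mul_sum] at h3
  have h4 : G.step i / 2 * -1 + m = G.left i := by rw [hm, step]; ring
  have h5 : G.step i / 2 * 1 + m = G.right i := by rw [hm, step]; ring
  rw [h4, h5] at h3
  rw [← h3]
  refine Finset.sum_congr rfl fun j _ => ?_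
  simp only [A, x, eval_comp, eval_add, eval_mul, eval_C, eval_X]
  ring

lemma sum_A (hk : 1 ≤ k) (i : Fin N) : ∑ j, G.A i j = G.step i := by
  have h := G.sum_A_mul_eval i (f := 1) (by rw [natDegree_one]; omega)
  simpa [polyIntegral_apply, step] using h

lemma A_le_step (hk : 1 ≤ k) (i : Fin N) (j : Fin (k + 2)) : G.A i j ≤ G.step i := by
  rw [← G.sum_A hk i]
  exact Finset.single_le_sum (fun l _ => G.A_nonneg hk i l) (Finset.mem_univ j)

end Grid

/-! ### Summation by parts -/

/-- Abel summation for partial sums `S j = b + d 0 + ⋯ + d j`, written with the complete sum of the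
increments, so that the last increment appears in two cancelling terms. -/
lemma sum_mul_sub_eq (n : ℕ) (S : Fin (n + 1) → ℝ) (F d : Fin (n + 2) → ℝ) (b : ℝ)
    (h0 : S 0 = b + d 0) (hS : ∀ j : Fin n, S j.succ = S j.castSucc + d j.succ.castSucc) :
    ∑ j : Fin (n + 1), S j * (F j.succ - F j.castSucc) =
      (b + ∑ j, d j) * F (Fin.last (n + 1)) - b * F 0 - ∑ j, d j * F j := by
  have hlast : ∀ (n : ℕ) (S : Fin (n + 1) → ℝ) (d : Fin (n + 2) → ℝ), S 0 = b + d 0 →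
      (∀ j : Fin n, S j.succ = S j.castSucc + d j.succ.castSucc) →
      S (Fin.last n) = b + ∑ j : Fin (n + 1), d j.castSucc := by
    intro n
    induction n with
    | zero => intro S d h0 _; simpa using h0
    | succ n ih =>
      intro S d h0 hS
      have h1 := hS (Fin.last n)
      rw [Fin.succ_last] at h1
      rw [h1, ih (fun j => S j.castSucc) (fun j => d j.castSucc) h0
        (fun j => hS j.castSucc), Fin.sum_univ_castSucc (fun j : Fin (n + 2) => d j.castSucc),
        add_assoc]
  induction n with
  | zero => simp [h0]; ring
  | succ n ih =>
    rw [Fin.sum_univ_castSucc]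
    have h1 := ih (fun j => S j.castSucc) (fun j => F j.castSucc) (fun j => d j.castSucc) h0
      (fun j => hS j.castSucc)
    simp only [Fin.succ_castSucc, Fin.castSucc_zero] at h1 ⊢
    rw [h1, hlast _ S d h0 hS, Fin.sum_univ_castSucc (fun j : Fin (n + 3) => d j),
      Fin.sum_univ_castSucc (fun j : Fin (n + 3) => d j * F j), Fin.succ_last]
    ring

namespace Grid

variable {k N : ℕ} (G : Grid k N)

/-- Summation by parts against `w*`: since the quadrature integrates `w_x` exactly, the partial sums
`w*` run from `w` at the left end point to `w` at the right end point. -/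
lemma sum_star_mul_sub (hk : 1 ≤ k) (w : DGSpace k N) (i : Fin N) (F : Fin (k + 2) → ℝ) :
    ∑ j : Fin (k + 1), G.star w i j * (F j.succ - F j.castSucc) =
      (w i : ℝ[X]).eval (G.right i) * F (Fin.last (k + 1)) - (w i : ℝ[X]).eval (G.left i) * F 0
        - ∑ j, G.A i j * (derivative (w i : ℝ[X])).eval (G.x i j) * F j := by
  rw [sum_mul_sub_eq k (G.star w i) F
    (fun j => G.A i j * (derivative (w i : ℝ[X])).eval (G.x i j)) ((w i : ℝ[X]).eval (G.left i))
    rfl (fun j => rfl)]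
  have hdeg : (derivative (w i : ℝ[X])).natDegree < (abscissae k (G.kind i)).card + k := by
    have h1 := natDegree_derivative_le (w i : ℝ[X])
    have h2 := natDegree_lt_of_mem_degreeLT (w i).2
    have h3 := le_card_abscissae k (G.kind i)
    omega
  rw [G.sum_A_mul_eval i hdeg, polyIntegral_derivative]
  ring

end Grid

/-! ### Time derivatives of polynomials -/

/-- A curve of polynomials of bounded degree which is differentiable pointwise has a polynomial as
its derivative, and linear functionals and bilinear forms may be differentiated along it. -/
lemma exists_hasDerivAt_of_differentiableAt_eval {n : ℕ} {p : ℝ → degreeLT ℝ n} {t : ℝ}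
    (hp : ∀ y, DifferentiableAt ℝ (fun τ => (p τ : ℝ[X]).eval y) t) :
    ∃ q ∈ degreeLT ℝ n,
      (∀ l : ℝ[X] →ₗ[ℝ] ℝ, HasDerivAt (fun τ => l (p τ)) (l q) t) ∧
      ∀ B : ℝ[X] →ₗ[ℝ] ℝ[X] →ₗ[ℝ] ℝ,
        HasDerivAt (fun τ => B (p τ) (p τ)) (B q (p t) + B (p t) q) t := by
  -- Expand in the Lagrange basis for the nodes `0, …, n - 1`.
  set y : Fin n → ℝ := fun j => (j : ℕ) with hy
  have hinj : Set.InjOn y (Finset.univ : Finset (Fin n)) := fun a _ b _ h => by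
    simpa [hy, Fin.ext_iff] using h
  set b : Fin n → ℝ[X] := Lagrange.basis Finset.univ y with hb
  have hexp : ∀ τ, (p τ : ℝ[X]) = ∑ j, (p τ : ℝ[X]).eval (y j) • b j := fun τ => by
    conv_lhs => rw [Lagrange.eq_interpolate hinj
      (by simpa using mem_degreeLT.1 (p τ).2 : (p τ : ℝ[X]).degree < _),
      Lagrange.interpolate_apply]
    simp [smul_eq_C_mul, hb]
  set q : ℝ[X] := ∑ j, deriv (fun τ => (p τ : ℝ[X]).eval (y j)) t • b j with hq
  have hlin : ∀ l : ℝ[X] →ₗ[ℝ] ℝ, HasDerivAt (fun τ => l (p τ)) (l q) t := by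
    intro l
    have h1 : ∀ τ, l (p τ) = ∑ j, (p τ : ℝ[X]).eval (y j) * l (b j) := fun τ => by
      conv_lhs => rw [hexp τ]
      simp
    simp only [h1, hq, map_sum, map_smul, smul_eq_mul]
    exact HasDerivAt.fun_sum fun j _ => (hp (y j)).hasDerivAt.mul_const _
  refine ⟨q, ?_, hlin, fun B => ?_⟩
  · refine Submodule.sum_mem _ fun j _ => Submodule.smul_mem _ _ (mem_degreeLT.2 ?_)
    rw [hb, Lagrange.degree_basis hinj (Finset.mem_univ j)]
    have := j.pos
    simpa using this
  · have h1 : ∀ τ r, B (p τ) r = ∑ j, (p τ : ℝ[X]).eval (y j) * B (b j) r := fun τ r => by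
      simpa using congrArg (fun z => B z r) (hexp τ)
    have h2 : B q (p t) = ∑ j, deriv (fun τ => (p τ : ℝ[X]).eval (y j)) t * B (b j) (p t) := by
      simp [hq]
    simp only [h1]
    rw [h2, ← Finset.sum_add_distrib]
    exact HasDerivAt.fun_sum fun j _ => (hp (y j)).hasDerivAt.mul (hlin (B (b j)))

lemma exists_derivative_eq (q : ℝ[X]) : ∃ V : ℝ[X], derivative V = q := by
  induction q using Polynomial.induction_on' with
  | add p q hp hq =>
    obtain ⟨V, hV⟩ := hp
    obtain ⟨W, hW⟩ := hq
    exact ⟨V + W, by rw [derivative_add, hV, hW]⟩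
  | monomial n a =>
    refine ⟨monomial (n + 1) (a / (n + 1)), ?_⟩
    rw [derivative_monomial]
    push_cast
    rw [div_mul_cancel₀ _ (by positivity : (n : ℝ) + 1 ≠ 0)]

lemma natDegree_le_of_derivative {k : ℕ} {V : ℝ[X]} (h : (derivative V).natDegree < k + 1) :
    V.natDegree ≤ k + 1 := by
  refine natDegree_le_iff_coeff_eq_zero.2 fun n hn => ?_
  obtain ⟨m, rfl⟩ : ∃ m, n = m + 1 := ⟨n - 1, by omega⟩
  have h1 : (derivative V).coeff m = 0 := coeff_eq_zero_of_natDegree_lt (by omega)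
  rw [coeff_derivative] at h1
  exact (mul_eq_zero.1 h1).resolve_right (by positivity)

/-! ### The discrete inner product `(q, w*)` -/

namespace Grid

variable {k N : ℕ} (G : Grid k N)

/-- The quadrature error on polynomials of degree at most `2k` is a nonnegative multiple of the
coefficient of degree `2k`, and it vanishes for Radau points. -/
lemma exists_quadrature_error (i : Fin N) :
    ∃ e : ℝ, 0 ≤ e ∧ (G.kind i ≠ .gauss → e = 0) ∧ ∀ f : ℝ[X], f.natDegree ≤ 2 * k →
      polyIntegral (G.left i) (G.right i) f - ∑ j, G.A i j * f.eval (G.x i j) =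
        e * f.coeff (2 * k) := by
  by_cases hg : G.kind i = .gauss
  · -- The error of the square of the monic node polynomial is its integral.
    set P : ℝ[X] := ∏ j ∈ abscissae k (G.kind i), (X - C (G.x i j)) with hP
    have hcard : (abscissae k (G.kind i)).card = k := by rw [hg, card_abscissae_gauss]
    have hmon : P.Monic := monic_prod_of_monic _ _ fun j _ => monic_X_sub_C _
    have hdeg : P.natDegree = k := by rw [hP, natDegree_finsetProd_X_sub_C_eq_card, hcard]
    have hmon2 : (P ^ 2).Monic := hmon.pow 2
    have hdeg2 : (P ^ 2).natDegree = 2 * k := by rw [hmon.natDegree_pow, hdeg]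
    have hcoeff : (P ^ 2).coeff (2 * k) = 1 := by rw [← hdeg2]; exact hmon2.coeff_natDegree
    have hquad : ∀ c : ℝ, ∑ j, G.A i j * (C c * P ^ 2).eval (G.x i j) = 0 := by
      refine fun c => Finset.sum_eq_zero fun j _ => ?_
      by_cases hj : j ∈ abscissae k (G.kind i)
      · have h0 : P.eval (G.x i j) = 0 := by
          rw [hP, eval_prod]
          exact Finset.prod_eq_zero hj (by simp)
        simp [h0]
      · rw [G.A_eq_zero_of_notMem i hj, zero_mul]
    refine ⟨polyIntegral (G.left i) (G.right i) (P ^ 2),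
      polyIntegral_sq_nonneg (G.left_lt_right i).le P, fun h => absurd hg h, fun f hf => ?_⟩
    set c := f.coeff (2 * k) with hc
    set g := f - C c * P ^ 2 with hgdef
    have hfg : f = g + C c * P ^ 2 := by rw [hgdef]; ring
    have hgint : ∑ j, G.A i j * g.eval (G.x i j) = polyIntegral (G.left i) (G.right i) g := by
      have hgle : g.natDegree ≤ 2 * k :=
        by
        simpa using natDegree_sub_le_of_le hf ((natDegree_C_mul_le c (P ^ 2)).trans hdeg2.le)
      have hg0 : g.coeff (2 * k) = 0 := by
        rw [hgdef, coeff_sub, coeff_C_mul, hcoeff, ← hc]; ring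
      rcases eq_or_ne k 0 with hk0 | hk0
      · have : g = 0 := by
          rw [eq_C_of_natDegree_le_zero (p := g) (by simpa [hk0] using hgle)]
          simpa [hk0] using hg0
        simp [this]
      · refine G.sum_A_mul_eval i ?_
        rw [hcard]
        refine lt_of_le_of_ne (hgle.trans (by omega)) fun h => ?_
        have hne : g ≠ 0 := by rintro h'; rw [h', natDegree_zero] at h; omega
        rw [← two_mul] at h
        rw [← h, coeff_natDegree, leadingCoeff_eq_zero] at hg0
        exact hne hg0
    have hsum : ∑ j, G.A i j * f.eval (G.x i j) = polyIntegral (G.left i) (G.right i) g := by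
      have hsplit := hquad c
      rw [← hgint, ← add_zero (∑ j, G.A i j * g.eval (G.x i j)), ← hsplit,
        ← Finset.sum_add_distrib]
      refine Finset.sum_congr rfl fun j _ => ?_
      conv_lhs => rw [hfg]
      rw [eval_add]; ring
    rw [hsum]
    conv_lhs => rw [hfg]
    rw [map_add, ← smul_eq_C_mul, map_smul, smul_eq_mul]
    ring
  · refine ⟨0, le_rfl, fun _ => rfl, fun f hf => ?_⟩
    have hcard : (abscissae k (G.kind i)).card = k + 1 := by
      cases hK : G.kind i with
      | gauss => exact absurd hK hg
      | radauRight => exact card_abscissae_radauRight k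
      | radauLeft => exact card_abscissae_radauLeft k
    rw [G.sum_A_mul_eval i (by omega)]
    ring

/-- The form `(q, w*)` on one element is the `L²` inner product, up to a symmetric and positive
semidefinite correction in the leading coefficients which is absent for Radau points. -/
lemma exists_star_inner_eq (hk : 1 ≤ k) (i : Fin N) :
    ∃ e : ℝ, 0 ≤ e ∧ (G.kind i ≠ .gauss → e = 0) ∧
      ∀ (w : DGSpace k N), ∀ q ∈ degreeLT ℝ (k + 1),
        ∑ j : Fin (k + 1), G.star w i j *
            ∫ y in (G.x i j.castSucc)..(G.x i j.succ), q.eval y =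
          polyIntegral (G.left i) (G.right i) ((w i : ℝ[X]) * q) +
            e * ((w i : ℝ[X]).coeff k * q.coeff k) := by
  obtain ⟨e, he0, hezero, he⟩ := G.exists_quadrature_error i
  refine ⟨e * (k / (k + 1)), by positivity, fun h => by rw [hezero h, zero_mul],
    fun w q hq => ?_⟩
  obtain ⟨V, hV⟩ := exists_derivative_eq q
  set p : ℝ[X] := (w i : ℝ[X]) with hp
  have hpdeg : p.natDegree < k + 1 := natDegree_lt_of_mem_degreeLT (w i).2
  have hp'deg : (derivative p).natDegree ≤ k - 1 :=
    (natDegree_derivative_le p).trans (by omega)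
  have hVdeg : V.natDegree ≤ k + 1 :=
    natDegree_le_of_derivative (by rw [hV]; exact natDegree_lt_of_mem_degreeLT hq)
  have h1 : ∀ j : Fin (k + 1), (∫ y in (G.x i j.castSucc)..(G.x i j.succ), q.eval y) =
      V.eval (G.x i j.succ) - V.eval (G.x i j.castSucc) := fun j => by
    rw [← polyIntegral_derivative, hV, polyIntegral_apply]
  simp only [h1]
  rw [G.sum_star_mul_sub hk w i (fun j => V.eval (G.x i j))]
  have h2 := he (derivative p * V) (natDegree_mul_le.trans (by omega))
  have h3 : (derivative p * V).coeff (2 * k) = (p.coeff k * k) * (q.coeff k / (k + 1)) := by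
    have h4 : 2 * k = (k - 1) + (k + 1) := by omega
    rw [h4, coeff_mul_add_eq_of_natDegree_le hp'deg hVdeg, coeff_derivative, ← hV, coeff_derivative,
      Nat.sub_add_cancel hk, mul_div_assoc, div_self (by positivity), mul_one]
    congr 2
    have : ((k - 1 : ℕ) : ℝ) + 1 = ((k - 1 + 1 : ℕ) : ℝ) := by push_cast; ring
    rw [this, Nat.sub_add_cancel hk]
  have h5 : polyIntegral (G.left i) (G.right i) (derivative p * V) +
      polyIntegral (G.left i) (G.right i) (p * q) =
        p.eval (G.right i) * V.eval (G.right i) - p.eval (G.left i) * V.eval (G.left i) := by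
    rw [← map_add, ← hV, ← derivative_mul, polyIntegral_derivative, eval_mul, eval_mul]
  rw [h3] at h2
  simp only [eval_mul, ← mul_assoc] at h2 h5 ⊢
  rw [G.x_zero, G.x_last]
  rw [← hp]
  linear_combination h2 - h5

end Grid

/-! ### The time derivative of the discrete norm -/

namespace Grid

variable {k N : ℕ} (G : Grid k N)

lemma normSq_eq (α : ℝ → ℝ) (v : DGSpace k N) :
    G.normSq α v = ∑ i, G.wt α i * polyIntegral (G.left i) (G.right i) ((v i : ℝ[X]) ^ 2) := by
  simp only [normSq, polyIntegral_apply, eval_pow]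

lemma wt_nonneg (α : ℝ → ℝ) (i : Fin N) : 0 ≤ G.wt α i := by
  unfold wt; positivity

lemma polyIntegral_sq_le_localStarNormSq (hk : 1 ≤ k) (v : DGSpace k N) (i : Fin N) :
    polyIntegral (G.left i) (G.right i) ((v i : ℝ[X]) ^ 2) ≤ G.localStarNormSq v i := by
  obtain ⟨e, he, -, h⟩ := G.exists_star_inner_eq hk i
  rw [localStarNormSq, h v _ (v i).2, sq]
  nlinarith [mul_nonneg he (mul_self_nonneg ((v i : ℝ[X]).coeff k))]

lemma normSq_le_starNormSq (hk : 1 ≤ k) (α : ℝ → ℝ) (v : DGSpace k N) :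
    G.normSq α v ≤ G.starNormSq α v := by
  rw [normSq_eq, starNormSq]
  exact Finset.sum_le_sum fun i _ => mul_le_mul_of_nonneg_left
    (G.polyIntegral_sq_le_localStarNormSq hk v i) (G.wt_nonneg α i)

lemma normSq_eq_starNormSq (hk : 1 ≤ k) (hG : ∀ i, G.kind i ≠ .gauss) (α : ℝ → ℝ)
    (v : DGSpace k N) : G.normSq α v = G.starNormSq α v := by
  rw [normSq_eq, starNormSq]
  refine Finset.sum_congr rfl fun i _ => ?_
  obtain ⟨e, -, he, h⟩ := G.exists_star_inner_eq hk i
  rw [localStarNormSq, h v _ (v i).2, he (hG i), sq, zero_mul, add_zero]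

/-- Since the form `(q, w*)` is symmetric, half the time derivative of `(v, v*)` is `(v_t, v*)`. -/
lemma hasDerivAt_localStarNormSq (hk : 1 ≤ k) {v : ℝ → DGSpace k N} {t : ℝ} (i : Fin N)
    (hv : ∀ y, DifferentiableAt ℝ (fun τ => (v τ i : ℝ[X]).eval y) t) :
    HasDerivAt (fun τ => G.localStarNormSq (v τ) i)
      (2 * ∑ j : Fin (k + 1), G.star (v t) i j *
        ∫ y in (G.x i j.castSucc)..(G.x i j.succ),
          deriv (fun τ => (v τ i : ℝ[X]).eval y) t) t := by
  obtain ⟨q, hq, hlin, hbil⟩ :=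
    exists_hasDerivAt_of_differentiableAt_eval (p := fun τ => v τ i) hv
  obtain ⟨e, -, -, he⟩ := G.exists_star_inner_eq hk i
  have hderiv : ∀ y, deriv (fun τ => (v τ i : ℝ[X]).eval y) t = q.eval y := fun y =>
    (hlin (leval y)).deriv
  simp only [hderiv]
  let B : ℝ[X] →ₗ[ℝ] ℝ[X] →ₗ[ℝ] ℝ :=
    (LinearMap.mul ℝ ℝ[X]).compr₂ (polyIntegral (G.left i) (G.right i)) +
      e • (LinearMap.mul ℝ ℝ).compl₁₂ (lcoeff ℝ k) (lcoeff ℝ k)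
  have hB : ∀ p r, B p r = polyIntegral (G.left i) (G.right i) (p * r) +
      e * (p.coeff k * r.coeff k) := fun p r => by simp [B]
  have hval : ∀ τ, G.localStarNormSq (v τ) i = B (v τ i) (v τ i) := fun τ => by
    rw [localStarNormSq, he (v τ) _ (v τ i).2, hB]
  simp only [hval]
  refine (hbil B).congr_deriv ?_
  rw [he (v t) q hq, hB, hB, mul_comm q]
  ring

lemma hasDerivAt_starNormSq (hk : 1 ≤ k) (α : ℝ → ℝ) {v : ℝ → DGSpace k N} {t : ℝ}
    (hv : ∀ i y, DifferentiableAt ℝ (fun τ => (v τ i : ℝ[X]).eval y) t) :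
    HasDerivAt (fun τ => G.starNormSq α (v τ))
      (2 * ∑ i, G.wt α i * ∑ j : Fin (k + 1), G.star (v t) i j *
        ∫ y in (G.x i j.castSucc)..(G.x i j.succ),
          deriv (fun τ => (v τ i : ℝ[X]).eval y) t) t := by
  have h := HasDerivAt.fun_sum (u := Finset.univ) fun i _ =>
    (G.hasDerivAt_localStarNormSq hk i (hv i)).const_mul (G.wt α i)
  refine h.congr_deriv ?_
  rw [Finset.mul_sum]
  exact Finset.sum_congr rfl fun i _ => by ring

end Grid

/-! ### Elementary inequalities at one interface -/

/-- Young's inequality, weighted by the length `h`. -/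
lemma mul_abs_mul_abs_le (h x y : ℝ) (hh : 0 ≤ h) :
    2 * (h * (|x| * |y|)) ≤ h * x ^ 2 + h * y ^ 2 := by
  have := mul_nonneg hh (sq_nonneg (|x| - |y|))
  rw [← sq_abs x, ← sq_abs y]
  linarith

/-- The upwind interface terms of two adjacent elements with squared weights `s²` and `r²`. For equal
weights they form a perfect square; in general the difference `s - r` is of the order of the step,
which the squared weights compensate because `|β|` is at most `s` and at most `r`. -/
lemma neg_interface_le {s r β a b h h' D M c ρ I I' : ℝ} (hs : 0 ≤ s) (hr : 0 ≤ r)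
    (hM : 0 ≤ M) (hρ : 0 ≤ ρ) (hh : 0 ≤ h) (hh' : 0 ≤ h') (hβs : |β| ≤ s) (hβr : |β| ≤ r)
    (hD : |s - r| ≤ D) (hDM : D ≤ M * (h + h')) (hhh : h ≤ ρ * h') (hhh' : h' ≤ ρ * h)
    (ha : h * a ^ 2 ≤ c * I) (hb : h' * b ^ 2 ≤ c * I') :
    -(s ^ 2 * (a * (β * if 0 < β then a else b) - β * a ^ 2 / 2) -
        r ^ 2 * (b * (β * if 0 < β then a else b) - β * b ^ 2 / 2)) ≤
      M * c * (1 + ρ) * (s ^ 2 * I + r ^ 2 * I') := by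
  have hsr : 0 ≤ s * r := mul_nonneg hs hr
  -- Both signs of `β` lead to the same cross term.
  have key : -(s ^ 2 * (a * (β * if 0 < β then a else b) - β * a ^ 2 / 2) -
      r ^ 2 * (b * (β * if 0 < β then a else b) - β * b ^ 2 / 2)) ≤
      (s * r) * (|a| * |b|) * D := by
    have hab : 0 ≤ |a| * |b| := by positivity
    have hD0 : 0 ≤ D := (abs_nonneg _).trans hD
    split_ifs with hβ
    · rw [abs_of_pos hβ] at hβs hβr
      have h1 : -(s ^ 2 * (a * (β * a) - β * a ^ 2 / 2) -
          r ^ 2 * (b * (β * a) - β * b ^ 2 / 2)) =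
          β * r * (a * b * (r - s)) - β / 2 * (s * a - r * b) ^ 2 := by ring
      have h2 : a * b * (r - s) ≤ |a| * |b| * D := by
        refine (le_abs_self _).trans ?_
        rw [abs_mul, abs_mul, abs_sub_comm r s]
        exact mul_le_mul_of_nonneg_left hD hab
      have h3 : 0 ≤ β / 2 * (s * a - r * b) ^ 2 := by positivity
      have h4 : β * r * (a * b * (r - s)) ≤ β * r * (|a| * |b| * D) :=
        mul_le_mul_of_nonneg_left h2 (by positivity)
      have h5 : β * r * (|a| * |b| * D) ≤ s * r * (|a| * |b| * D) :=
        mul_le_mul_of_nonneg_right (mul_le_mul_of_nonneg_right hβs hr) (by positivity)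
      rw [h1]; linarith
    · have hβ' : 0 ≤ -β := by linarith
      rw [abs_of_nonpos (by linarith)] at hβs hβr
      have h1 : -(s ^ 2 * (a * (β * b) - β * a ^ 2 / 2) -
          r ^ 2 * (b * (β * b) - β * b ^ 2 / 2)) =
          -β * s * (a * b * (s - r)) - -β / 2 * (s * a - r * b) ^ 2 := by ring
      have h2 : a * b * (s - r) ≤ |a| * |b| * D := by
        refine (le_abs_self _).trans ?_
        rw [abs_mul, abs_mul]
        exact mul_le_mul_of_nonneg_left hD hab
      have h3 : 0 ≤ -β / 2 * (s * a - r * b) ^ 2 := by positivity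
      have h4 : -β * s * (a * b * (s - r)) ≤ -β * s * (|a| * |b| * D) :=
        mul_le_mul_of_nonneg_left h2 (by positivity)
      have h5 : -β * s * (|a| * |b| * D) ≤ r * s * (|a| * |b| * D) :=
        mul_le_mul_of_nonneg_right (mul_le_mul_of_nonneg_right hβr hs) (by positivity)
      rw [h1]; linarith
  refine key.trans ?_
  have hP : 0 ≤ (s * r) * (|a| * |b|) := by positivity
  have y1 := mul_abs_mul_abs_le h (s * a) (r * b) hh
  have y2 := mul_abs_mul_abs_le h' (s * a) (r * b) hh'
  rw [abs_mul, abs_mul, abs_of_nonneg hs, abs_of_nonneg hr] at y1 y2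
  have cI : 0 ≤ c * I := le_trans (by positivity) ha
  have cI' : 0 ≤ c * I' := le_trans (by positivity) hb
  have z1 : h * (s * a) ^ 2 ≤ s ^ 2 * (c * I) := by
    have := mul_le_mul_of_nonneg_left ha (sq_nonneg s); linarith [mul_pow s a 2]
  have z2 : h' * (r * b) ^ 2 ≤ r ^ 2 * (c * I') := by
    have := mul_le_mul_of_nonneg_left hb (sq_nonneg r); linarith [mul_pow r b 2]
  have z3 : h * (r * b) ^ 2 ≤ ρ * (h' * (r * b) ^ 2) := by
    rw [← mul_assoc]; exact mul_le_mul_of_nonneg_right hhh (sq_nonneg _)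
  have z4 : h' * (s * a) ^ 2 ≤ ρ * (h * (s * a) ^ 2) := by
    rw [← mul_assoc]; exact mul_le_mul_of_nonneg_right hhh' (sq_nonneg _)
  have z5 := mul_le_mul_of_nonneg_left z1 hρ
  have z6 := mul_le_mul_of_nonneg_left z2 hρ
  have w1 : 0 ≤ s ^ 2 * (c * I) := by positivity
  have w2 : 0 ≤ r ^ 2 * (c * I') := by positivity
  have w3 : 0 ≤ ρ * (s ^ 2 * (c * I)) := by positivity
  have w4 : 0 ≤ ρ * (r ^ 2 * (c * I')) := by positivity
  have hsum : (h + h') * ((s * r) * (|a| * |b|)) ≤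
      (1 + ρ) * (s ^ 2 * (c * I) + r ^ 2 * (c * I')) := by
    linarith
  calc (s * r) * (|a| * |b|) * D ≤ (s * r) * (|a| * |b|) * (M * (h + h')) :=
        mul_le_mul_of_nonneg_left hDM hP
    _ = M * ((h + h') * ((s * r) * (|a| * |b|))) := by ring
    _ ≤ M * ((1 + ρ) * (s ^ 2 * (c * I) + r ^ 2 * (c * I'))) :=
        mul_le_mul_of_nonneg_left hsum hM
    _ = _ := by ring

/-- The quadrature node at an end point sees the upwind value `b` of the neighbouring element instead
of the inner value `a`. If the coefficient `β` there and the weight `s` are of the order of the step,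
this is harmless. -/
lemma endpoint_correction_le {s r β a b d w h h' M c ρ I I' : ℝ} (hs : 0 ≤ s) (hr : 0 ≤ r)
    (hM : 0 ≤ M) (hh : 0 ≤ h) (hβr : |β| ≤ r) (hβM : |β| ≤ M * h)
    (hsM : s ≤ 2 * M * h) (hw0 : 0 ≤ w) (hwh : w ≤ h) (hhh : h ≤ ρ * h') (hρ : 0 ≤ ρ)
    (hh' : 0 ≤ h')
    (ha : h * a ^ 2 ≤ c * I) (hd : h ^ 3 * d ^ 2 ≤ c * I) (hb : h' * b ^ 2 ≤ c * I') :
    s ^ 2 * (w * d * (β * (b - a))) ≤ M * c * (2 + ρ) * (s ^ 2 * I + r ^ 2 * I') := by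
  have cI : 0 ≤ c * I := le_trans (by positivity) ha
  have cI' : 0 ≤ c * I' := le_trans (by positivity) hb
  have h1 : w * d * (β * (b - a)) ≤ h * |d| * (|β| * |b|) + h * |d| * (|β| * |a|) := by
    calc w * d * (β * (b - a)) ≤ |w * d * (β * (b - a))| := le_abs_self _
      _ = w * |d| * (|β| * |b - a|) := by rw [abs_mul, abs_mul, abs_mul, abs_of_nonneg hw0]
      _ ≤ h * |d| * (|β| * (|b| + |a|)) := by
          gcongr
          exact abs_sub b a
      _ = _ := by ring
  have h2 : h * |d| * (|β| * |a|) ≤ M * (c * I) := by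
    have y := mul_abs_mul_abs_le h (h * d) a hh
    rw [abs_mul, abs_of_nonneg hh] at y
    have e : h * (h * d) ^ 2 = h ^ 3 * d ^ 2 := by ring
    have y' : h * (h * |d| * |a|) ≤ c * I := by linarith
    calc h * |d| * (|β| * |a|) ≤ h * |d| * (M * h * |a|) := by gcongr
      _ = M * (h * (h * |d| * |a|)) := by ring
      _ ≤ _ := mul_le_mul_of_nonneg_left y' hM
  have h3 : s ^ 2 * (h * |d| * (|β| * |b|)) ≤
      M * (s ^ 2 * (c * I)) + M * ρ * (r ^ 2 * (c * I')) := by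
    have y := mul_abs_mul_abs_le h (h * (s * d)) (r * b) hh
    rw [abs_mul, abs_mul, abs_mul, abs_of_nonneg hh, abs_of_nonneg hs, abs_of_nonneg hr] at y
    have z1 : h * (h * (s * d)) ^ 2 ≤ s ^ 2 * (c * I) := by
      have := mul_le_mul_of_nonneg_left hd (sq_nonneg s)
      calc _ = s ^ 2 * (h ^ 3 * d ^ 2) := by ring
        _ ≤ _ := this
    have z2 : h * (r * b) ^ 2 ≤ ρ * (r ^ 2 * (c * I')) := by
      calc h * (r * b) ^ 2 ≤ ρ * h' * (r * b) ^ 2 :=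
            mul_le_mul_of_nonneg_right hhh (sq_nonneg _)
        _ = ρ * (r ^ 2 * (h' * b ^ 2)) := by ring
        _ ≤ _ := by gcongr
    calc s ^ 2 * (h * |d| * (|β| * |b|)) = s * (s * (h * |d| * (|β| * |b|))) := by ring
      _ ≤ 2 * M * h * (s * (h * |d| * (r * |b|))) := by gcongr
      _ = M * (2 * (h * (h * (s * |d|) * (r * |b|)))) := by ring
      _ ≤ M * (s ^ 2 * (c * I) + ρ * (r ^ 2 * (c * I'))) :=
          mul_le_mul_of_nonneg_left (by linarith) hM
      _ = _ := by ring
  have h4 := mul_le_mul_of_nonneg_left h1 (sq_nonneg s)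
  have h5 := mul_le_mul_of_nonneg_left h2 (sq_nonneg s)
  have w1 : 0 ≤ M * ρ * (s ^ 2 * (c * I)) := by positivity
  have w2 : 0 ≤ M * (r ^ 2 * (c * I')) := by positivity
  linarith

lemma abs_sqrt_sub_sqrt_le (x y β : ℝ) :
    |√(x ^ 2 + β ^ 2) - √(β ^ 2 + y ^ 2)| ≤ |x - y| := by
  have hs := Real.sqrt_nonneg (x ^ 2 + β ^ 2)
  have hr := Real.sqrt_nonneg (β ^ 2 + y ^ 2)
  have hs2 := Real.sq_sqrt (show 0 ≤ x ^ 2 + β ^ 2 by positivity)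
  have hr2 := Real.sq_sqrt (show 0 ≤ β ^ 2 + y ^ 2 by positivity)
  set s := √(x ^ 2 + β ^ 2)
  set r := √(β ^ 2 + y ^ 2)
  have hx : |x| ≤ s := Real.abs_le_sqrt (by nlinarith [sq_nonneg β])
  have hy : |y| ≤ r := Real.abs_le_sqrt (by nlinarith [sq_nonneg β])
  rcases (add_nonneg hs hr).eq_or_lt with h0 | h0
  · have h1 : s = 0 := by linarith
    have h2 : r = 0 := by linarith
    rw [h1, h2]; simp
  · refine le_of_mul_le_mul_right ?_ h0
    calc |s - r| * (s + r) = |(s - r) * (s + r)| := by rw [abs_mul, abs_of_pos h0]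
      _ = |(x - y) * (x + y)| := by congr 1; linarith
      _ = |x - y| * |x + y| := abs_mul _ _
      _ ≤ |x - y| * (s + r) := by
          gcongr
          exact (abs_add_le x y).trans (add_le_add hx hy)

namespace Grid

/-! ### The flux part of the scheme on one element -/

variable {k N : ℕ} (G : Grid k N)

lemma left_mem (i : Fin N) : G.left i ∈ Set.Icc 0 (2 * Real.pi) := by
  rw [← G.first, ← G.last]
  exact ⟨G.strictMono.monotone (Fin.zero_le _), G.strictMono.monotone (Fin.le_last _)⟩

lemma right_mem (i : Fin N) : G.right i ∈ Set.Icc 0 (2 * Real.pi) := by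
  rw [← G.first, ← G.last]
  exact ⟨G.strictMono.monotone (Fin.zero_le _), G.strictMono.monotone (Fin.le_last _)⟩

/-- The flux part of the local form, tested with `v*`. -/
noncomputable def flux [NeZero N] (α : ℝ → ℝ) (v : DGSpace k N) (i : Fin N) : ℝ :=
  ∑ j : Fin (k + 1), G.star v i j *
    (α (G.x i j.succ) * G.hat α v i j.succ - α (G.x i j.castSucc) * G.hat α v i j.castSucc)

/-- After summation by parts the upwind flux enters at the end points, and the quadrature sees the
inner values of `v` except for the corrections at end points which are abscissae. -/
lemma flux_eq [NeZero N] (hk : 1 ≤ k) (α : ℝ → ℝ) (v : DGSpace k N) (i : Fin N) :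
    G.flux α v i =
      (v i : ℝ[X]).eval (G.right i) * (α (G.right i) * G.hat α v i (Fin.last (k + 1)))
      - (v i : ℝ[X]).eval (G.left i) * (α (G.left i) * G.hat α v i 0)
      - (∑ j, G.A i j * (α (G.x i j) *
          (derivative (v i : ℝ[X]) * (v i : ℝ[X])).eval (G.x i j)))
      - G.A i 0 * (derivative (v i : ℝ[X])).eval (G.left i) *
          (α (G.left i) * (G.hat α v i 0 - (v i : ℝ[X]).eval (G.left i)))
      - G.A i (Fin.last (k + 1)) * (derivative (v i : ℝ[X])).eval (G.right i) *
          (α (G.right i) *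
            (G.hat α v i (Fin.last (k + 1)) - (v i : ℝ[X]).eval (G.right i))) := by
  rw [flux, G.sum_star_mul_sub hk v i (fun j => α (G.x i j) * G.hat α v i j), G.x_zero, G.x_last]
  have hne : (0 : Fin (k + 2)) ≠ Fin.last (k + 1) := by simp [Fin.ext_iff]
  have h1 : ∑ j, (G.A i j * (derivative (v i : ℝ[X])).eval (G.x i j) *
        (α (G.x i j) * G.hat α v i j) -
      G.A i j * (α (G.x i j) * (derivative (v i : ℝ[X]) * (v i : ℝ[X])).eval (G.x i j))) =
      G.A i 0 * (derivative (v i : ℝ[X])).eval (G.left i) *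
          (α (G.left i) * (G.hat α v i 0 - (v i : ℝ[X]).eval (G.left i))) +
      G.A i (Fin.last (k + 1)) * (derivative (v i : ℝ[X])).eval (G.right i) *
          (α (G.right i) *
            (G.hat α v i (Fin.last (k + 1)) - (v i : ℝ[X]).eval (G.right i))) := by
    rw [Finset.sum_eq_add (0 : Fin (k + 2)) (Fin.last (k + 1)) hne]
    · rw [G.x_zero, G.x_last, eval_mul, eval_mul]; ring
    · intro j _ hj
      rw [eval_mul, hat, if_neg hj.1, if_neg hj.2]; ring
    · simp
    · simp
  rw [Finset.sum_sub_distrib] at h1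
  linear_combination -h1

/-- The quadrature of `α v_x v` is the integral of an exact derivative up to a term controlled by the
`L²` norm: freezing `α` costs one power of the step, which the inverse inequality for `v_x`
consumes. -/
lemma sum_A_mul_alpha_le (hk : 1 ≤ k) {α : ℝ → ℝ} {M c : ℝ} (hM : 0 ≤ M)
    (hα : ∀ x ∈ Set.Icc 0 (2 * Real.pi), ∀ y ∈ Set.Icc 0 (2 * Real.pi),
      |α x - α y| ≤ M * |x - y|)
    (hc : ∀ p ∈ degreeLT ℝ (k + 1), ∀ a b : ℝ, a < b → ∀ x ∈ Set.Icc a b,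
      (b - a) * p.eval x ^ 2 ≤ c * polyIntegral a b (p ^ 2) ∧
      (b - a) ^ 3 * (derivative p).eval x ^ 2 ≤ c * polyIntegral a b (p ^ 2))
    {p : ℝ[X]} (hp : p ∈ degreeLT ℝ (k + 1)) (i : Fin N) :
    ∑ j, G.A i j * (α (G.x i j) * (derivative p * p).eval (G.x i j)) ≤
      (α (G.right i) * p.eval (G.right i) ^ 2 - α (G.left i) * p.eval (G.left i) ^ 2) / 2 +
        2 * M * c * polyIntegral (G.left i) (G.right i) (p ^ 2) := by
  have hh := G.step_pos i
  have hlr := G.left_lt_right i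
  set I := polyIntegral (G.left i) (G.right i) (p ^ 2) with hI
  set h := G.step i with hstep
  have hinv : ∀ x ∈ Set.Icc (G.left i) (G.right i),
      h * p.eval x ^ 2 ≤ c * I ∧ h ^ 3 * (derivative p).eval x ^ 2 ≤ c * I :=
    fun x hx => hc p hp _ _ hlr x hx
  have hLip : ∀ x ∈ Set.Icc (G.left i) (G.right i), |α x - α (G.left i)| ≤ M * h := by
    intro x hx
    refine (hα x (Set.Icc_subset_Icc (G.left_mem i).1 (G.right_mem i).2 hx) _
      (G.left_mem i)).trans (mul_le_mul_of_nonneg_left ?_ hM)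
    rw [abs_of_nonneg (sub_nonneg.2 hx.1)]
    exact sub_le_sub_right hx.2 _
  have hdeg : (derivative p * p).natDegree < (abscissae k (G.kind i)).card + k := by
    have h1 := natDegree_derivative_le p
    have h2 := natDegree_lt_of_mem_degreeLT hp
    have h3 := le_card_abscissae k (G.kind i)
    have h4 := natDegree_mul_le (p := derivative p) (q := p)
    omega
  have hexact : ∑ j, G.A i j * (derivative p * p).eval (G.x i j) =
      (p.eval (G.right i) ^ 2 - p.eval (G.left i) ^ 2) / 2 := by
    rw [G.sum_A_mul_eval i hdeg]
    have h1 := polyIntegral_derivative (G.left i) (G.right i) (p ^ 2)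
    have h2 : derivative (p ^ 2) = (2 : ℝ) • (derivative p * p) := by
      rw [derivative_sq, smul_eq_C_mul]; ring
    rw [h2, map_smul, smul_eq_mul, eval_pow, eval_pow] at h1
    linarith
  have hterm : ∀ j, G.A i j * (α (G.x i j) * (derivative p * p).eval (G.x i j)) ≤
      α (G.left i) * (G.A i j * (derivative p * p).eval (G.x i j)) +
        G.A i j * (M * c * I / h) := by
    intro j
    obtain ⟨h1, h2⟩ := hinv _ (G.x_mem i j)
    set a := p.eval (G.x i j)
    set d := (derivative p).eval (G.x i j)
    have y := mul_abs_mul_abs_le h (h * d) a hh.le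
    rw [abs_mul, abs_of_pos hh] at y
    have e : h * (h * d) ^ 2 = h ^ 3 * d ^ 2 := by ring
    have h3 : |d| * |a| * h ≤ c * I / h := by
      rw [le_div_iff₀ hh]; linarith
    have h4 : (α (G.x i j) - α (G.left i)) * (d * a) ≤ M * c * I / h := by
      calc _ ≤ |(α (G.x i j) - α (G.left i)) * (d * a)| := le_abs_self _
        _ = |α (G.x i j) - α (G.left i)| * (|d| * |a|) := by rw [abs_mul, abs_mul]
        _ ≤ M * h * (|d| * |a|) :=
            mul_le_mul_of_nonneg_right (hLip _ (G.x_mem i j)) (by positivity)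
        _ = M * (|d| * |a| * h) := by ring
        _ ≤ M * (c * I / h) := mul_le_mul_of_nonneg_left h3 hM
        _ = _ := by ring
    have h5 := mul_le_mul_of_nonneg_left h4 (G.A_nonneg hk i j)
    rw [eval_mul]
    linarith
  have hsum := Finset.sum_le_sum fun j (_ : j ∈ Finset.univ) => hterm j
  rw [Finset.sum_add_distrib, ← Finset.mul_sum, ← Finset.sum_mul, G.sum_A hk, hexact, ← hstep,
    mul_div_cancel₀ _ hh.ne'] at hsum
  have hR := hinv _ (Set.right_mem_Icc.2 hlr.le)
  have hend : (α (G.left i) - α (G.right i)) * p.eval (G.right i) ^ 2 ≤ M * (c * I) := by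
    calc _ ≤ |α (G.right i) - α (G.left i)| * p.eval (G.right i) ^ 2 := by
          rw [abs_sub_comm]
          exact mul_le_mul_of_nonneg_right (le_abs_self _) (sq_nonneg _)
      _ ≤ M * h * p.eval (G.right i) ^ 2 :=
          mul_le_mul_of_nonneg_right (hLip _ (Set.right_mem_Icc.2 hlr.le)) (sq_nonneg _)
      _ = M * (h * p.eval (G.right i) ^ 2) := by ring
      _ ≤ _ := mul_le_mul_of_nonneg_left hR.1 hM
  have hMcI : 0 ≤ M * (c * I) := mul_nonneg hM (le_trans (by positivity) hR.1)
  linarith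

/-! ### Periodicity -/

section Periodic

variable [NeZero N]

lemma alpha_left_add_one {α : ℝ → ℝ} (hper : α 0 = α (2 * Real.pi)) (i : Fin N) :
    α (G.left (i + 1)) = α (G.right i) := by
  cases N with
  | zero => exact i.elim0
  | succ n =>
    induction i using Fin.lastCases with
    | last => rw [Fin.last_add_one, left, right, Fin.succ_last, Fin.castSucc_zero, G.first, G.last,
        hper]
    | cast j => rw [Fin.coeSucc_eq_succ, left, right, Fin.succ_castSucc]

lemma hat_last (α : ℝ → ℝ) (v : DGSpace k N) (i : Fin N) :
    G.hat α v i (Fin.last (k + 1)) = if 0 < α (G.right i) then (v i : ℝ[X]).eval (G.right i)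
      else (v (i + 1) : ℝ[X]).eval (G.left (i + 1)) := by
  rw [hat, if_neg (by simp [Fin.ext_iff]), if_pos rfl]

/-- The upwind flux is single valued at every interface. -/
lemma hat_add_one_zero {α : ℝ → ℝ} (hper : α 0 = α (2 * Real.pi)) (v : DGSpace k N) (i : Fin N) :
    G.hat α v (i + 1) 0 = G.hat α v i (Fin.last (k + 1)) := by
  rw [hat_last, hat, if_pos rfl, G.alpha_left_add_one hper, add_sub_cancel_right]

lemma sum_add_one (f : Fin N → ℝ) : ∑ i, f (i + 1) = ∑ i, f i :=
  Equiv.sum_comp (Equiv.addRight (1 : Fin N)) f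

/-! ### Stability of the flux -/

/-- The energy estimate for the flux part of the scheme, with a constant independent of the mesh. -/
lemma neg_sum_wt_mul_flux_le (hk : 1 ≤ k) {α : ℝ → ℝ} {M c ρ : ℝ} (hM : 0 ≤ M)
    (hα : ∀ x ∈ Set.Icc 0 (2 * Real.pi), ∀ y ∈ Set.Icc 0 (2 * Real.pi),
      |α x - α y| ≤ M * |x - y|)
    (hper : α 0 = α (2 * Real.pi))
    (hc : ∀ p ∈ degreeLT ℝ (k + 1), ∀ a b : ℝ, a < b → ∀ x ∈ Set.Icc a b,
      (b - a) * p.eval x ^ 2 ≤ c * polyIntegral a b (p ^ 2) ∧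
      (b - a) ^ 3 * (derivative p).eval x ^ 2 ≤ c * polyIntegral a b (p ^ 2))
    (hρ0 : 0 ≤ ρ) (hρ : G.ShapeRegular ρ) (hG : G.IsRSV α ∨ G.IsLSV) (v : DGSpace k N) :
    -∑ i, G.wt α i * G.flux α v i ≤ M * c * (12 + 6 * ρ) * G.normSq α v := by
  set I : Fin N → ℝ := fun i => polyIntegral (G.left i) (G.right i) ((v i : ℝ[X]) ^ 2) with hI
  set pR : Fin N → ℝ := fun i => (v i : ℝ[X]).eval (G.right i) with hpR
  set pL : Fin N → ℝ := fun i => (v i : ℝ[X]).eval (G.left i) with hpL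
  set E : Fin N → ℝ := fun i => G.wt α i * I i with hE
  have hI0 : ∀ i, 0 ≤ I i := fun i => polyIntegral_sq_nonneg (G.left_lt_right i).le _
  have hsq : ∀ i, √(G.wt α i) ^ 2 = G.wt α i := fun i => Real.sq_sqrt (G.wt_nonneg α i)
  have hαL : ∀ i, |α (G.left i)| ≤ √(G.wt α i) := fun i =>
    Real.abs_le_sqrt (by rw [wt]; nlinarith [sq_nonneg (α (G.right i))])
  have hαR : ∀ i, |α (G.right i)| ≤ √(G.wt α i) := fun i =>
    Real.abs_le_sqrt (by rw [wt]; nlinarith [sq_nonneg (α (G.left i))])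
  have hper1 := G.alpha_left_add_one hper
  have hdiff : ∀ i, |α (G.left i) - α (G.right i)| ≤ M * G.step i := fun i => by
    have h1 := hα _ (G.right_mem i) _ (G.left_mem i)
    rwa [abs_sub_comm, abs_of_pos (sub_pos.2 (G.left_lt_right i))] at h1
  have hinvR : ∀ i, G.step i * pR i ^ 2 ≤ c * I i ∧
      G.step i ^ 3 * (derivative (v i : ℝ[X])).eval (G.right i) ^ 2 ≤ c * I i := fun i =>
    hc _ (v i).2 _ _ (G.left_lt_right i) _ (Set.right_mem_Icc.2 (G.left_lt_right i).le)
  have hinvL : ∀ i, G.step i * pL i ^ 2 ≤ c * I i ∧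
      G.step i ^ 3 * (derivative (v i : ℝ[X])).eval (G.left i) ^ 2 ≤ c * I i := fun i =>
    hc _ (v i).2 _ _ (G.left_lt_right i) _ (Set.left_mem_Icc.2 (G.left_lt_right i).le)
  have hcI : ∀ i, 0 ≤ c * I i := fun i =>
    le_trans (mul_nonneg (G.step_pos i).le (sq_nonneg _)) (hinvR i).1
  have hcE : ∀ i, 0 ≤ c * E i := fun i => by
    have := mul_nonneg (G.wt_nonneg α i) (hcI i)
    simp only [hE]; linarith
  -- An element on which the end values of `α` do not share a sign carries a weight of the order of the squared step.
  have hsmall : ∀ i, α (G.left i) * α (G.right i) ≤ 0 →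
      |α (G.left i)| ≤ M * G.step i ∧ |α (G.right i)| ≤ M * G.step i ∧
        √(G.wt α i) ≤ 2 * M * G.step i := by
    intro i hi
    have h1 := hdiff i
    have h2 : (α (G.left i) - α (G.right i)) ^ 2 ≤ (M * G.step i) ^ 2 :=
      sq_le_sq.2 (h1.trans (le_abs_self _))
    have h3 : 0 ≤ M * G.step i := mul_nonneg hM (G.step_pos i).le
    refine ⟨abs_le_of_sq_le_sq (by nlinarith [sq_nonneg (α (G.right i))]) h3,
      abs_le_of_sq_le_sq (by nlinarith [sq_nonneg (α (G.left i))]) h3, ?_⟩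
    rw [Real.sqrt_le_left (by linarith)]
    rw [wt]; nlinarith
  -- The interface terms.
  have hface : ∀ i, -(G.wt α i * (pR i * (α (G.right i) * G.hat α v i (Fin.last (k + 1))) -
        α (G.right i) * pR i ^ 2 / 2) -
      G.wt α (i + 1) * (pL (i + 1) * (α (G.left (i + 1)) * G.hat α v (i + 1) 0) -
        α (G.left (i + 1)) * pL (i + 1) ^ 2 / 2)) ≤
      M * c * (1 + ρ) * (E i + E (i + 1)) := by
    intro i
    rw [G.hat_add_one_zero hper, G.hat_last, hper1, ← hsq i, ← hsq (i + 1)]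
    have h1 : |α (G.right i)| ≤ √(G.wt α (i + 1)) := hper1 i ▸ hαL (i + 1)
    have h2 : |√(G.wt α i) - √(G.wt α (i + 1))| ≤ |α (G.left i) - α (G.right (i + 1))| := by
      have := abs_sqrt_sub_sqrt_le (α (G.left i)) (α (G.right (i + 1))) (α (G.right i))
      rw [wt, wt, hper1]
      exact this
    have h3 : |α (G.left i) - α (G.right (i + 1))| ≤ M * (G.step i + G.step (i + 1)) := by
      have h4 := hdiff (i + 1)
      rw [hper1] at h4
      have h5 := abs_sub_le (α (G.left i)) (α (G.right i)) (α (G.right (i + 1)))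
      linarith [hdiff i]
    have := neg_interface_le (Real.sqrt_nonneg (G.wt α i)) (Real.sqrt_nonneg (G.wt α (i + 1))) hM
      hρ0 (G.step_pos i).le (G.step_pos (i + 1)).le (hαR i) h1 h2 h3 (hρ _ _) (hρ _ _)
      (hinvR i).1 (hinvL (i + 1)).1
    simpa only [hE, hsq] using this
  -- The corrections at the right end points.
  have hcorrR : ∀ i, G.wt α i * (G.A i (Fin.last (k + 1)) *
        (derivative (v i : ℝ[X])).eval (G.right i) *
          (α (G.right i) * (G.hat α v i (Fin.last (k + 1)) - pR i))) ≤
      M * c * (2 + ρ) * (E i + E (i + 1)) := by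
    intro i
    have hnn : 0 ≤ M * c * (2 + ρ) * (E i + E (i + 1)) := by
      have h1 : 0 ≤ M * (2 + ρ) * (c * E i + c * E (i + 1)) :=
        mul_nonneg (mul_nonneg hM (by linarith)) (add_nonneg (hcE i) (hcE (i + 1)))
      linarith
    by_cases hpos : 0 < α (G.right i)
    · rw [G.hat_last, if_pos hpos, sub_self]; simpa using hnn
    by_cases hkind : G.kind i = .radauRight
    · rw [G.hat_last, if_neg hpos, ← hsq i]
      have hprod : α (G.left i) * α (G.right i) ≤ 0 := by
        rcases (not_lt.1 hpos).eq_or_lt with h0 | h0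
        · rw [h0, mul_zero]
        · rcases lt_or_ge (α (G.left i)) 0 with h1 | h1
          · rcases hG with hG | hG
            · have := (hG i).2.2 h1 h0
              rw [hkind] at this; cases this
            · have := hG i
              rw [hkind] at this; cases this
          · exact mul_nonpos_of_nonneg_of_nonpos h1 h0.le
      obtain ⟨-, h2, h3⟩ := hsmall i hprod
      have := endpoint_correction_le (Real.sqrt_nonneg (G.wt α i))
        (Real.sqrt_nonneg (G.wt α (i + 1))) hM (G.step_pos i).le (hper1 i ▸ hαL (i + 1)) h2 h3
        (G.A_nonneg hk i (Fin.last (k + 1))) (G.A_le_step hk i _) (hρ (i + 1) i) hρ0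
        (G.step_pos (i + 1)).le (hinvR i).1 (hinvR i).2 (hinvL (i + 1)).1
      simpa only [hE, hsq] using this
    · have : Fin.last (k + 1) ∉ abscissae k (G.kind i) := by
        cases hK : G.kind i with
        | gauss => simp [abscissae]
        | radauRight => exact absurd hK hkind
        | radauLeft => simp [abscissae]
      rw [G.A_eq_zero_of_notMem i this]
      simpa using hnn
  -- The corrections at the left end points, indexed by the left neighbour.
  have hcorrL : ∀ i, G.wt α (i + 1) * (G.A (i + 1) 0 *
        (derivative (v (i + 1) : ℝ[X])).eval (G.left (i + 1)) *
          (α (G.left (i + 1)) * (G.hat α v (i + 1) 0 - pL (i + 1)))) ≤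
      M * c * (2 + ρ) * (E (i + 1) + E i) := by
    intro i
    have hnn : 0 ≤ M * c * (2 + ρ) * (E (i + 1) + E i) := by
      have h1 : 0 ≤ M * (2 + ρ) * (c * E i + c * E (i + 1)) :=
        mul_nonneg (mul_nonneg hM (by linarith)) (add_nonneg (hcE i) (hcE (i + 1)))
      linarith
    rw [G.hat_add_one_zero hper, G.hat_last, ← hper1]
    by_cases hpos : 0 < α (G.left (i + 1))
    · by_cases hkind : G.kind (i + 1) = .radauLeft
      · rw [if_pos hpos, ← hsq (i + 1)]
        have hprod : α (G.left (i + 1)) * α (G.right (i + 1)) ≤ 0 := by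
          rcases lt_or_ge 0 (α (G.right (i + 1))) with h1 | h1
          · rcases hG with hG | hG
            · have := (hG (i + 1)).2.1 hpos h1
              rw [hkind] at this; cases this
            · have := hG (i + 1)
              rw [hkind] at this; cases this
          · exact mul_nonpos_of_nonneg_of_nonpos hpos.le h1
        obtain ⟨h2, -, h3⟩ := hsmall (i + 1) hprod
        have := endpoint_correction_le (Real.sqrt_nonneg (G.wt α (i + 1)))
          (Real.sqrt_nonneg (G.wt α i)) hM (G.step_pos (i + 1)).le
          ((hper1 i).symm ▸ hαR i) h2 h3
          (G.A_nonneg hk (i + 1) 0) (G.A_le_step hk (i + 1) _) (hρ i (i + 1)) hρ0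
          (G.step_pos i).le (hinvL (i + 1)).1 (hinvL (i + 1)).2 (hinvR i).1
        simpa only [hE, hsq] using this
      · have : (0 : Fin (k + 2)) ∉ abscissae k (G.kind (i + 1)) := by
          cases hK : G.kind (i + 1) with
          | gauss => simp [abscissae]
          | radauRight => simp [abscissae]
          | radauLeft => exact absurd hK hkind
        rw [G.A_eq_zero_of_notMem (i + 1) this]
        simpa using hnn
    · rw [if_neg hpos]
      simpa [hpL] using hnn
  -- The quadrature of `α v_x v`.
  have hvol : ∀ i, G.wt α i * (∑ j, G.A i j * (α (G.x i j) *
        (derivative (v i : ℝ[X]) * (v i : ℝ[X])).eval (G.x i j))) ≤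
      G.wt α i * ((α (G.right i) * pR i ^ 2 - α (G.left i) * pL i ^ 2) / 2) +
        2 * M * c * E i := by
    intro i
    have := mul_le_mul_of_nonneg_left (G.sum_A_mul_alpha_le hk hM hα hc (v i).2 i)
      (G.wt_nonneg α i)
    refine this.trans_eq ?_
    simp only [hE, hI, hpR, hpL]; ring
  set FR : Fin N → ℝ := fun i => G.wt α i *
    (pR i * (α (G.right i) * G.hat α v i (Fin.last (k + 1))) - α (G.right i) * pR i ^ 2 / 2)
  set FL : Fin N → ℝ := fun i => G.wt α i *
    (pL i * (α (G.left i) * G.hat α v i 0) - α (G.left i) * pL i ^ 2 / 2)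
  set CR : Fin N → ℝ := fun i => G.wt α i * (G.A i (Fin.last (k + 1)) *
    (derivative (v i : ℝ[X])).eval (G.right i) *
      (α (G.right i) * (G.hat α v i (Fin.last (k + 1)) - pR i)))
  set CL : Fin N → ℝ := fun i => G.wt α i * (G.A i 0 *
    (derivative (v i : ℝ[X])).eval (G.left i) *
      (α (G.left i) * (G.hat α v i 0 - pL i)))
  have hloc : ∀ i, -(G.wt α i * G.flux α v i) ≤
      -FR i + FL i + CR i + CL i + 2 * M * c * E i := by
    intro i
    have h1 := hvol i
    rw [G.flux_eq hk]
    simp only [FR, FL, CR, CL, hpR, hpL] at h1 ⊢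
    linarith
  have hnorm : G.normSq α v = ∑ i, E i := G.normSq_eq α v
  have hsumE : ∑ i, (E i + E (i + 1)) = 2 * ∑ i, E i := by
    rw [Finset.sum_add_distrib, sum_add_one]; ring
  have hnonneg : 0 ≤ M * c * ∑ i, E i := by
    rw [mul_assoc, Finset.mul_sum]
    exact mul_nonneg hM (Finset.sum_nonneg fun i _ => hcE i)
  calc -∑ i, G.wt α i * G.flux α v i = ∑ i, -(G.wt α i * G.flux α v i) := by
        rw [Finset.sum_neg_distrib]
    _ ≤ ∑ i, (-FR i + FL i + CR i + CL i + 2 * M * c * E i) :=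
        Finset.sum_le_sum fun i _ => hloc i
    _ = ∑ i, (-(FR i - FL (i + 1)) + CR i + CL (i + 1) + 2 * M * c * E i) := by
        simp only [Finset.sum_add_distrib, Finset.sum_neg_distrib, Finset.sum_sub_distrib,
          sum_add_one]
        ring
    _ ≤ ∑ i, (M * c * (5 + 3 * ρ) * (E i + E (i + 1)) + 2 * M * c * E i) := by
        refine Finset.sum_le_sum fun i _ => ?_
        have h1 := hface i
        have h2 := hcorrR i
        have h3 := hcorrL i
        simp only [FR, FL, CR, CL] at h1 h2 h3 ⊢
        linarith
    _ = M * c * (12 + 6 * ρ) * ∑ i, E i := by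
        rw [Finset.sum_add_distrib, ← Finset.mul_sum, ← Finset.mul_sum, hsumE]; ring
    _ = _ := by rw [hnorm]

lemma weightedForm_eq (α : ℝ → ℝ) (v : ℝ → DGSpace k N) (t : ℝ) :
    G.weightedForm α v t (G.star (v t)) =
      (∑ i, G.wt α i * ∑ j : Fin (k + 1), G.star (v t) i j *
        ∫ y in (G.x i j.castSucc)..(G.x i j.succ),
          deriv (fun τ => (v τ i : ℝ[X]).eval y) t) +
      ∑ i, G.wt α i * G.flux α (v t) i := by
  rw [weightedForm, ← Finset.sum_add_distrib]
  exact Finset.sum_congr rfl fun i _ => by rw [a, flux]; ring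

end Periodic

end Grid

end SpectralVolume

theorem theorem3p3 (k : ℕ) (hk : 1 ≤ k) (α : ℝ → ℝ)
    (hα : ContDiffOn ℝ (⊤ : ℕ∞) α (Set.Icc 0 (2 * Real.pi)))
    (hper : α 0 = α (2 * Real.pi)) (ρ : ℝ) :
    ∃ C : ℝ, 0 < C ∧
      ∀ (N : ℕ) [NeZero N] (G : SpectralVolume.Grid k N), G.ShapeRegular ρ →
      ∀ (v : ℝ → SpectralVolume.DGSpace k N) (t : ℝ),
        (∀ (i : Fin N) (y : ℝ),
          DifferentiableAt ℝ (fun τ => (v τ i : Polynomial ℝ).eval y) t) →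
        (G.IsRSV α →
          DifferentiableAt ℝ (fun τ => G.normSq α (v τ)) t ∧
          1 / 2 * deriv (fun τ => G.normSq α (v τ)) t ≤
            C * (|G.weightedForm α v t (G.star (v t))| + G.normSq α (v t))) ∧
        (G.IsLSV →
          DifferentiableAt ℝ (fun τ => G.starNormSq α (v τ)) t ∧
          1 / 2 * deriv (fun τ => G.starNormSq α (v τ)) t ≤
            C * (|G.weightedForm α v t (G.star (v t))| + G.starNormSq α (v t))) := by
  obtain ⟨M, hM⟩ := hα.exists_lipschitzOnWith (by simp) (convex_Icc _ _) isCompact_Icc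
  have hLip : ∀ x ∈ Set.Icc 0 (2 * Real.pi), ∀ y ∈ Set.Icc 0 (2 * Real.pi),
      |α x - α y| ≤ M * |x - y| := fun x hx y hy => by
    simpa [Real.dist_eq] using hM.dist_le_mul x hx y hy
  obtain ⟨c, hc0, hc⟩ := SpectralVolume.exists_inverse_inequality k
  refine ⟨1 + M * c * (12 + 6 * |ρ|), by positivity, fun N _ G hG v t hv => ?_⟩
  -- Both cases concern the discrete norm, which coincides with the `L²` norm for Radau points.
  have main : (G.IsRSV α ∨ G.IsLSV) →
      DifferentiableAt ℝ (fun τ => G.starNormSq α (v τ)) t ∧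
      1 / 2 * deriv (fun τ => G.starNormSq α (v τ)) t ≤
        (1 + M * c * (12 + 6 * |ρ|)) *
          (|G.weightedForm α v t (G.star (v t))| + G.starNormSq α (v t)) := by
    intro hkind
    have hderiv := G.hasDerivAt_starNormSq hk α hv
    refine ⟨hderiv.differentiableAt, ?_⟩
    have hG' : G.ShapeRegular |ρ| := fun i j =>
      (hG i j).trans (mul_le_mul_of_nonneg_right (le_abs_self ρ) (G.step_pos i).le)
    have hflux := G.neg_sum_wt_mul_flux_le hk M.coe_nonneg hLip hper hc (abs_nonneg ρ) hG' hkind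
      (v t)
    have hform := G.weightedForm_eq α v t
    have hle := G.normSq_le_starNormSq hk α (v t)
    have hnn : 0 ≤ G.normSq α (v t) := by
      rw [G.normSq_eq]
      exact Finset.sum_nonneg fun i _ => mul_nonneg (G.wt_nonneg α i)
        (SpectralVolume.polyIntegral_sq_nonneg (G.left_lt_right i).le _)
    have hK : 0 ≤ (M : ℝ) * c * (12 + 6 * |ρ|) := by positivity
    rw [hderiv.deriv]
    have h1 := mul_le_mul_of_nonneg_left hle hK
    have h2 := mul_nonneg hK (abs_nonneg (G.weightedForm α v t (G.star (v t))))
    have h3 := le_abs_self (G.weightedForm α v t (G.star (v t)))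
    linarith
  constructor
  · intro hR
    have hne : ∀ i, G.kind i ≠ .gauss := fun i h => by
      rcases (hR i).1 with h' | h' <;> rw [h] at h' <;> cases h'
    simp only [G.normSq_eq_starNormSq hk hne]
    exact main (Or.inl hR)
  · exact fun hL => main (Or.inr hL)
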